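/- All graphs are finite and undirected; loops are allowed in the target graphs and their factors, while the input graphs $G$ are simple. A homomorphism $A\to B$ is an adjacency-preserving map $V(A)\to V(B)$. A graph is a *core* if each of its endomorphisms is an automorphism, and *trivial* if its core (the induced subgraph, unique up to isomorphism, that is a core and to which the graph has a homomorphism) has at most two vertices. In the direct product $A\times B$, $(a,b)$ and $(a',b')$ are adjacent iff $aa'\in E(A)$ and $bb'\in E(B)$; $A^\ell$ is the $\ell$-fold direct product, and $K_1^*$ is one vertex with a loop. A graph on at least two vertices is *prime* if in each factorization $A\times B$ of it $A=K_1^*$ or $B=K_1^*$. Let $H$ be a fixed non-trivial core with a prime factorization $H=H_1\times\dots\times H_m$ ($m\ge 1$, all $H_j$ prime), and let $i\in[m]$. $H$ is *$H_i$-projective* if $H_i$ is non-trivial and for every $\ell\ge 2$, every homomorphism $f:H_1\times\dots\times H_{i-1}\times H_i^\ell\times H_{i+1}\times\dots\times H_m\to H_i$ that satisfies $f(y_1,\dots,y_{i-1},x,\dots,x,y_{i+1},\dots,y_m)=x$ for all $x\in V(H_i)$, $y_j\in V(H_j)$ is the projection to one of the $\ell$ coordinates belonging to $H_i^\ell$.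 For $T\subseteq V(H_i)$ put $S(T)=\bigcap_{t\in T}N(t)$; the *signature number* $s(H_i)$ is the number of distinct non-empty sets of the form $S(T)$ with $T\neq\emptyset$. **Theorem.** If $H$ is $H_i$-projective and the Strong Exponential Time Hypothesis holds (for every $\delta>0$ there is a $k$ such that $k$-SAT on $n$ variables cannot be solved in time $\mathcal O^*((2-\delta)^n)$), then for no $\varepsilon>0$ is there an algorithm that decides for every input graph $G$ whether there is a homomorphism $G\to H$ (the problem $H$-Coloring) in time $\mathcal O^*\big((s(H_i)-\varepsilon)^{\mathrm{cw}(G)}\big)$. Here $\mathrm{cw}(G)$ is the clique-width of $G$, and $\mathcal O^*$ suppresses factors polynomial in the size of the input. -/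

import Mathlib

universe u

/-! ### Graphs with possible loops -/

/-- An undirected graph without multiple edges, in which loops are allowed. Homomorphisms are
Mathlib's relation homomorphisms `→r` between the adjacency relations, isomorphisms are `≃r`. -/
structure LoopGraph (V : Type*) where
  Adj : V → V → Prop
  symm : ∀ ⦃v w : V⦄, Adj v w → Adj w v

namespace LoopGraph

/-- The subgraph induced by a set of vertices. -/
def induce {V : Type*} (H : LoopGraph V) (U : Set V) : LoopGraph U where
  Adj x y := H.Adj x y
  symm _ _ h := H.symm h

/-- The direct product of two graphs. -/
def prod {V W : Type*} (A : LoopGraph V) (B : LoopGraph W) : LoopGraph (V × W) where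
  Adj x y := A.Adj x.1 y.1 ∧ B.Adj x.2 y.2
  symm _ _ h := ⟨A.symm h.1, B.symm h.2⟩

/-- The direct product of a family of graphs. -/
def pi {ι : Type*} {W : ι → Type*} (F : ∀ i, LoopGraph (W i)) : LoopGraph (∀ i, W i) where
  Adj x y := ∀ i, (F i).Adj (x i) (y i)
  symm _ _ h i := (F i).symm (h i)

/-- The `l`-th power with respect to the direct product. -/
def pow {V : Type*} (H : LoopGraph V) (l : ℕ) : LoopGraph (Fin l → V) :=
  pi fun _ : Fin l => H

/-- The graph is (isomorphic to) `K₁*`: one vertex, with a loop. -/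
def IsLoopVertex {V : Type*} (H : LoopGraph V) : Prop :=
  ∃ v, H.Adj v v ∧ ∀ w, w = v

/-- A graph is a core if each of its endomorphisms is an automorphism. -/
def IsCore {V : Type*} (H : LoopGraph V) : Prop :=
  ∀ f : H.Adj →r H.Adj, ∃ e : H.Adj ≃r H.Adj, ∀ v, e v = f v

/-- A graph is trivial if its core (an induced subgraph that is a core and to which the graph
has a homomorphism) has at most two vertices. -/
def IsTrivial {V : Type*} (H : LoopGraph V) : Prop :=
  ∃ U : Set V, U.Finite ∧ U.ncard ≤ 2 ∧ (H.induce U).IsCore ∧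
    Nonempty (H.Adj →r (H.induce U).Adj)

/-- A graph on at least two vertices is prime if in every factorization into two graphs (with
possible loops) one of the factors is `K₁*`. -/
def IsPrime {V : Type u} (H : LoopGraph V) : Prop :=
  Nontrivial V ∧ ∀ (A B : Type u) (K : LoopGraph A) (L : LoopGraph B),
    Nonempty (H.Adj ≃r (K.prod L).Adj) → K.IsLoopVertex ∨ L.IsLoopVertex

/-- The family `F` is a prime factorization of `H`. If `H` is prime, the family with the single
member `H` is one. -/
def IsPrimeFactorization {V : Type u} (H : LoopGraph V) {m : ℕ} {W : Fin m → Type u}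
    (F : ∀ i, LoopGraph (W i)) : Prop :=
  (∀ i, (F i).IsPrime) ∧ Nonempty (H.Adj ≃r (pi F).Adj)

/-- The product of the family `F` is `F i`-projective: the factor `F i` is nontrivial, and every
homomorphism from the product of `F i ^ l` and all `F j` with `j ≠ i` to `F i` which is
`F i`-idempotent is the projection to one of the `l` coordinates in `F i`. -/
def IsProjectiveAt {m : ℕ} {W : Fin m → Type*} (F : ∀ i, LoopGraph (W i)) (i : Fin m) : Prop :=
  ¬ (F i).IsTrivial ∧
    ∀ l : ℕ, 2 ≤ l →
      ∀ f : (((F i).pow l).prod (pi fun j : {j : Fin m // j ≠ i} => F j)).Adj →r (F i).Adj,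
        (∀ (x : W i) (y : ∀ j : {j : Fin m // j ≠ i}, W j), f (fun _ => x, y) = x) →
          ∃ q : Fin l, ∀ (x : Fin l → W i) (y : ∀ j : {j : Fin m // j ≠ i}, W j), f (x, y) = x q

/-- The common neighbourhood `S(T)` of the vertices of `T`. -/
def signature {V : Type*} (H : LoopGraph V) (T : Set V) : Set V :=
  {v | ∀ t ∈ T, H.Adj t v}

/-- The set of all signature sets: the nonempty sets `S(T)` for nonempty `T`. -/
def signatureSets {V : Type*} (H : LoopGraph V) : Set (Set V) :=
  {S | S.Nonempty ∧ ∃ T : Set V, T.Nonempty ∧ S = H.signature T}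

/-- The signature number `s(H)`, for finite graphs. -/
noncomputable def signatureNumber {V : Type*} (H : LoopGraph V) : ℕ :=
  H.signatureSets.ncard

end LoopGraph

/-! ### Clique-width -/

/-- Clique-width expressions with labels in `Fin k`. -/
inductive CWExpr (k : ℕ) : Type
  | vertex (i : Fin k) : CWExpr k
  | union (a b : CWExpr k) : CWExpr k
  | relabel (i j : Fin k) (a : CWExpr k) : CWExpr k
  | join (i j : Fin k) (hij : i ≠ j) (a : CWExpr k) : CWExpr k

namespace CWExpr

/-- The vertices of the evaluation. -/
def Vert {k : ℕ} : CWExpr k → Type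
  | vertex _ => Unit
  | union a b => a.Vert ⊕ b.Vert
  | relabel _ _ a => a.Vert
  | join _ _ _ a => a.Vert

/-- The labels of the vertices of the evaluation. -/
def label {k : ℕ} : (a : CWExpr k) → a.Vert → Fin k
  | vertex i => fun _ => i
  | union a b => Sum.elim a.label b.label
  | relabel i j a => fun v => if a.label v = i then j else a.label v
  | join _ _ _ a => a.label

/-- The graph of the evaluation. -/
def graph {k : ℕ} : (a : CWExpr k) → SimpleGraph a.Vert
  | vertex _ => (⊥ : SimpleGraph Unit)
  | union a b => a.graph.sum b.graph
  | relabel _ _ a => a.graph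
  | join i j _ a =>
      a.graph ⊔ SimpleGraph.fromRel (fun u v => a.label u = i ∧ a.label v = j)

end CWExpr

/-- The clique-width of a finite graph: the least `k` such that some `k`-expression defines the
graph. The graph without vertices gets the value `0`. -/
noncomputable def cliqueWidth {V : Type*} (G : SimpleGraph V) : ℕ :=
  sInf {k : ℕ | ∃ a : CWExpr k, Nonempty (a.graph ≃g G)}

/-! ### Algorithms and their running time -/

/-- The data of the machine model: binary trees built from `nil` by pairing. -/
abbrev Data : Type := BinaryTree Unit

/-- The size of a data object. -/
def Data.size (x : Data) : ℕ := x.numNodes + 1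

/-- Programs on binary trees (a `WHILE` language over `nil`, `cons`, `hd`, `tl`). In memory a tree
is a pointer to a cell with two pointers, as in a list-processing language, so every step below
takes constant time on a random access machine; conversely `t` steps of a (log-cost or word) random
access machine take `t` times a factor polynomial in `log t` and in the size of the input, the
memory being kept in a balanced tree. Such factors do not matter for `O*`-bounds. -/
inductive Prog : Type
  /-- return the input -/
  | id : Prog
  /-- return `nil` -/
  | nil : Prog
  /-- return the left component of the input (`nil` if the input is `nil`) -/
  | hd : Prog
  /-- return the right component of the input (`nil` if the input is `nil`) -/
  | tl : Prog
  /-- run `p` and `q` on the input and return the pair of the results -/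
  | cons (p q : Prog) : Prog
  /-- run `p`, then run `q` on the result -/
  | seq (p q : Prog) : Prog
  /-- run `q` on the input if `c` returns a pair on it, and `r` if `c` returns `nil` -/
  | ite (c q r : Prog) : Prog
  /-- as long as `c` returns a pair on the current value, replace that value by the result of `p` -/
  | loop (c p : Prog) : Prog

/-- `Runs p x y t`: on input `x` the program `p` halts with result `y` after exactly `t` steps. -/
inductive Runs : Prog → Data → Data → ℕ → Prop
  | id (x : Data) : Runs .id x x 1
  | nil (x : Data) : Runs .nil x .nil 1
  | hd (x : Data) : Runs .hd x x.left 1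
  | tl (x : Data) : Runs .tl x x.right 1
  | cons {p q : Prog} {x y z : Data} {s t : ℕ} :
      Runs p x y s → Runs q x z t → Runs (.cons p q) x (.node () y z) (s + t + 1)
  | seq {p q : Prog} {x y z : Data} {s t : ℕ} :
      Runs p x y s → Runs q y z t → Runs (.seq p q) x z (s + t + 1)
  | ite_nil {c q r : Prog} {x z : Data} {s t : ℕ} :
      Runs c x .nil s → Runs r x z t → Runs (.ite c q r) x z (s + t + 1)
  | ite_node {c q r : Prog} {x a b z : Data} {s t : ℕ} :
      Runs c x (.node () a b) s → Runs q x z t → Runs (.ite c q r) x z (s + t + 1)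
  | loop_nil {c p : Prog} {x : Data} {s : ℕ} :
      Runs c x .nil s → Runs (.loop c p) x x (s + 1)
  | loop_node {c p : Prog} {x a b y z : Data} {s t r : ℕ} :
      Runs c x (.node () a b) s → Runs p x y t → Runs (.loop c p) y z r →
        Runs (.loop c p) x z (s + t + r + 1)

/-- The decision problem with set of instances `I`, encoding `enc` and set of yes-instances `yes`
is solvable in time `O*(β)`: some program halts on the encoding of every instance `x`, returns
`nil` exactly if the answer is no, and takes at most `β x` times a polynomial in the size of the
input many steps. -/
def SolvableInOStar {I : Type} (enc : I → Data) (yes : I → Prop) (β : I → ℝ) : Prop :=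
  ∃ (p : Prog) (c d : ℕ), ∀ x : I, ∃ (y : Data) (t : ℕ), Runs p (enc x) y t ∧
    (y ≠ .nil ↔ yes x) ∧ (t : ℝ) ≤ c * ((enc x).size : ℝ) ^ d * β x

/-! ### Encodings -/

/-- The encoding of a list of data objects. -/
def encodeList : List Data → Data
  | [] => .nil
  | a :: l => .node () a (encodeList l)

/-- The encoding of a truth value. -/
def encodeBool : Bool → Data
  | false => .nil
  | true => .node () .nil .nil

/-- The unary encoding of a natural number. -/
def encodeNat (n : ℕ) : Data := encodeList (List.replicate n .nil)

open Classical in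
/-- The encoding of a graph by its adjacency matrix, as a list of rows. -/
noncomputable def encodeGraph {n : ℕ} (G : SimpleGraph (Fin n)) : Data :=
  encodeList (List.ofFn fun u : Fin n =>
    encodeList (List.ofFn fun v : Fin n => encodeBool (decide (G.Adj u v))))

/-! ### Satisfiability and the Strong Exponential Time Hypothesis -/

/-- Formulas in conjunctive normal form with `n` variables. A literal is a variable together with
the truth value that satisfies the literal. -/
structure CNFFormula where
  n : ℕ
  clauses : List (List (Fin n × Bool))

namespace CNFFormula

/-- All clauses have at most `k` literals. -/
def HasWidth (φ : CNFFormula) (k : ℕ) : Prop :=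
  ∀ c ∈ φ.clauses, c.length ≤ k

/-- Some assignment satisfies a literal of each clause. -/
def Satisfiable (φ : CNFFormula) : Prop :=
  ∃ a : Fin φ.n → Bool, ∀ c ∈ φ.clauses, ∃ l ∈ c, a l.1 = l.2

/-- The encoding of a formula: the number of variables and the list of clauses. -/
def encode (φ : CNFFormula) : Data :=
  .node () (encodeNat φ.n) (encodeList (φ.clauses.map fun c =>
    encodeList (c.map fun l => .node () (encodeNat l.1) (encodeBool l.2))))

end CNFFormula

/-- The Strong Exponential Time Hypothesis: for every `ε > 0` there is a `k` such that `k`-SAT with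
`n` variables is not solvable in time `O*((2 - ε)^n)`. -/
def SETH : Prop :=
  ∀ ε : ℝ, 0 < ε → ∃ k : ℕ,
    ¬ SolvableInOStar (I := {φ : CNFFormula // φ.HasWidth k}) (fun φ => φ.1.encode)
      (fun φ => φ.1.Satisfiable) (fun φ => (2 - ε) ^ φ.1.n)

/-! ### The homomorphism problem -/

/-- The problem `H`-Coloring is solvable in time `O*(b^(cw(G)))`: the instances are all finite
simple graphs `G`, and the question is whether there is a homomorphism from `G` to `H`. -/
def HColoringSolvable {V : Type*} (H : LoopGraph V) (b : ℝ) : Prop :=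
  SolvableInOStar (I := Σ n : ℕ, SimpleGraph (Fin n)) (fun G => encodeGraph G.2)
    (fun G => Nonempty (G.2.Adj →r H.Adj)) (fun G => b ^ cliqueWidth G.2)

open Polynomial

/-! Write `H` as `A × B`, where `A` is the projective factor, and let `s` be its signature number.
Satisfiability is reduced to `H`-Coloring in such a way that `n` variables cost a clique-width of
about `n / log₂ s`. The variables are cut into `nb` blocks of size `a`, and the assignments of a
block are encoded by `b`-tuples of signature sets, where `2 ^ a ≤ s ^ b`.

The graph consists of layers. The main part of a layer is a copy of `A ^ D × B`, where an element of
`D` is a `b`-tuple together with a bit. Consecutive layers are linked along their diagonals. Since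
`H` is a core, a homomorphism to `H` may be assumed to be the identity on the diagonal of the first
layer; since distinct vertices of a loopless core have incomparable neighbourhoods, it is then the
identity on all diagonals. By projectivity its `A`-coordinate on each layer is the projection to
some `d ∈ D`, so a homomorphism is a choice of one `d` per layer (`exists_choice_of_hom`,
`hom_of_choice`).

The layers serve the blocks cyclically. The bit is handed from each layer to the next and evaluates
the clauses literal by literal. A signature set `T` of a block is handed to the next layer of the
same block, `nb` layers later: port vertices of the earlier layer take all colours in `S(T)`, and
they are joined to vertices of the later layer that take all colours in the new set `T'`. This
enforces `T' ⊆ S(S(T)) = T`. All ports for one of the `b` positions have the same later neighbours,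
so they can share a label. Hence each block costs `b` labels, and everything else costs a constant
number (`cliqueWidth_graph_le`).

Only inclusions are enforced, not equalities. But the sets can only shrink, in total at most `nb * b
* |A|` times, so if the formula is evaluated more often than that, the block states are constant
during some whole evaluation (`exists_constant_period`) and give a satisfying assignment.

Finally let `β' = max (s - ε) 1`. There are `a` and `b` with `β' ^ b < 2 ^ a ≤ s ^ b`, and an
algorithm with base `s - ε` would solve `k`-SAT for every `k` in time `O*(q ^ n)`, where `q = β' ^
(b / a) < 2`. -/

theorem Polynomial.eval_le_eval_of_le (P : ℕ[X]) {a b : ℕ} (h : a ≤ b) : P.eval a ≤ P.eval b := by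
  induction P using Polynomial.induction_on' with
  | add p q hp hq => simpa using Nat.add_le_add hp hq
  | monomial n c => simpa using Nat.mul_le_mul_left c (Nat.pow_le_pow_left h n)

/-! ### Data objects as lists, and their sizes -/

namespace Data

@[simp] theorem size_nil : Data.size (.nil : Data) = 1 := rfl

@[simp] theorem size_node (a b : Data) : Data.size (.node () a b) = a.size + b.size := by
  simp only [Data.size, BinaryTree.numNodes]; omega

theorem one_le_size (a : Data) : 1 ≤ a.size := by simp [Data.size]

theorem size_left_le (a : Data) : Data.size a.left ≤ a.size := by
  cases a with
  | nil => simp [BinaryTree.left]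
  | node u a b => cases u; simp [BinaryTree.left]

theorem size_right_le (a : Data) : Data.size a.right ≤ a.size := by
  cases a with
  | nil => simp [BinaryTree.right]
  | node u a b => cases u; simp [BinaryTree.right]

/-- The pairing operation on data objects. -/
abbrev pair (a b : Data) : Data := .node () a b

/-- Every data object is a list of data objects. -/
def toList : Data → List Data
  | .nil => []
  | .node _ a b => a :: toList b

@[simp] theorem toList_nil : toList .nil = [] := rfl
@[simp] theorem toList_pair (a b : Data) : toList (.node () a b) = a :: toList b := rfl

@[simp] theorem toList_encodeList (l : List Data) : toList (encodeList l) = l := by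
  induction l with
  | nil => rfl
  | cons a l ih => simp [encodeList, ih]

@[simp] theorem encodeList_toList (x : Data) : encodeList x.toList = x := by
  induction x with
  | nil => rfl
  | node u a b _ ih => simp [encodeList, toList, ih]

theorem size_encodeList (l : List Data) :
    (encodeList l).size = (l.map Data.size).sum + 1 := by
  induction l with
  | nil => rfl
  | cons a l ih => simp [encodeList, ih, add_assoc]

theorem length_lt_size_encodeList (l : List Data) : l.length < (encodeList l).size := by
  induction l with
  | nil => simp [encodeList]
  | cons a l ih => simp [encodeList]; have := one_le_size a; omega

theorem size_le_of_mem {l : List Data} {a : Data} (h : a ∈ l) : a.size ≤ (encodeList l).size := by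
  induction l with
  | nil => simp at h
  | cons b l ih =>
    simp only [encodeList, size_node]
    rcases List.mem_cons.1 h with rfl | h
    · omega
    · have := ih h; omega

end Data

/-! ### Closure properties of polynomial-time functions -/

open Data

/-- The function `f` is computed by a program whose running time and output size are bounded by a
polynomial in the size of the input. -/
def PolyTime (f : Data → Data) : Prop :=
  ∃ (p : Prog) (P : ℕ[X]), ∀ x, (f x).size ≤ P.eval x.size ∧
    ∃ t, t ≤ P.eval x.size ∧ Runs p x (f x) t

namespace PolyTime

variable {f g h : Data → Data}

theorem congr (hf : PolyTime f) (e : ∀ x, f x = g x) : PolyTime g := by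
  rwa [← funext e]

protected theorem id : PolyTime fun x => x :=
  ⟨.id, X + 1, fun x => ⟨by simp, 1, by simp, .id x⟩⟩

protected theorem nil : PolyTime fun _ => .nil :=
  ⟨.nil, 1, fun x => ⟨by simp, 1, by simp, .nil x⟩⟩

/-- The bound on the output size in `PolyTime` is needed here: a time bound alone does not give one,
since `cons id id` doubles a tree in a constant number of steps. -/
theorem comp (hg : PolyTime g) (hf : PolyTime f) : PolyTime fun x => g (f x) := by
  obtain ⟨p, P, hp⟩ := hf
  obtain ⟨q, Q, hq⟩ := hg
  refine ⟨.seq p q, P + Q.comp P + 1, fun x => ?_⟩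
  obtain ⟨h1, s, hs, h2⟩ := hp x
  obtain ⟨h3, t, ht, h4⟩ := hq (f x)
  have := Q.eval_le_eval_of_le h1
  refine ⟨?_, s + t + 1, ?_, .seq h2 h4⟩ <;> simp <;> omega

theorem left (hf : PolyTime f) : PolyTime fun x => (f x).left :=
  comp (g := fun x => x.left)
    ⟨.hd, X + 1, fun x => ⟨by simpa using (size_left_le x).trans (Nat.le_succ _), 1, by simp, .hd x⟩⟩
    hf

theorem right (hf : PolyTime f) : PolyTime fun x => (f x).right :=
  comp (g := fun x => x.right)
    ⟨.tl, X + 1, fun x => ⟨by simpa using (size_right_le x).trans (Nat.le_succ _), 1, by simp, .tl x⟩⟩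
    hf

protected theorem pair (hf : PolyTime f) (hg : PolyTime g) :
    PolyTime fun x => .node () (f x) (g x) := by
  obtain ⟨p, P, hp⟩ := hf
  obtain ⟨q, Q, hq⟩ := hg
  refine ⟨.cons p q, P + Q + 1, fun x => ?_⟩
  obtain ⟨h1, s, hs, h2⟩ := hp x
  obtain ⟨h3, t, ht, h4⟩ := hq x
  refine ⟨?_, s + t + 1, ?_, .cons h2 h4⟩ <;> simp <;> omega

protected theorem ite (hf : PolyTime f) (hg : PolyTime g) (hh : PolyTime h) :
    PolyTime fun x => if f x = .nil then h x else g x := by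
  have e : ∀ x a b, f x = .node () a b → (if f x = .nil then h x else g x) = g x := by
    intro x a b e; rw [e]; exact if_neg (by simp)
  have e' : ∀ x, f x = .nil → (if f x = .nil then h x else g x) = h x := fun x e => if_pos e
  obtain ⟨p, P, hp⟩ := hf
  obtain ⟨q, Q, hq⟩ := hg
  obtain ⟨r, R, hr⟩ := hh
  refine ⟨.ite p q r, P + Q + R + 1, fun x => ?_⟩
  obtain ⟨h1, s, hs, h2⟩ := hp x
  obtain ⟨h3, t, ht, h4⟩ := hq x
  obtain ⟨h5, u, hu, h6⟩ := hr x
  obtain hfx | ⟨a, b, hfx⟩ : f x = .nil ∨ ∃ a b, f x = .node () a b := by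
    rcases f x with _ | ⟨_, a, b⟩ <;> simp
  · beta_reduce; rw [e' x hfx]
    rw [hfx] at h2
    refine ⟨?_, s + u + 1, ?_, .ite_nil h2 h6⟩ <;> simp <;> omega
  · beta_reduce; rw [e x a b hfx]
    rw [hfx] at h2
    refine ⟨?_, s + t + 1, ?_, .ite_node h2 h4⟩ <;> simp <;> omega

theorem _root_.encodeBool_eq_nil (b : Bool) : encodeBool b = .nil ↔ b = false := by
  cases b <;> simp [encodeBool]

theorem ite_decide {P : Data → Prop} [DecidablePred P]
    (hP : PolyTime fun x => encodeBool (decide (P x))) (hg : PolyTime g) (hh : PolyTime h) :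
    PolyTime fun x => if P x then g x else h x := by
  refine (PolyTime.ite hP hg hh).congr fun x => ?_
  by_cases h : P x <;> simp [h, encodeBool_eq_nil]

theorem const (c : Data) : PolyTime fun _ => c := by
  induction c with
  | nil => exact .nil
  | node _ a b iha ihb => exact iha.pair ihb

theorem eq_const (hf : PolyTime f) (c : Data) :
    PolyTime fun x => encodeBool (decide (f x = c)) := by
  induction c generalizing f with
  | nil =>
    refine (PolyTime.ite hf .nil (const (encodeBool true))).congr fun x => ?_
    by_cases h : f x = .nil
    · simp only [h, if_true, decide_true]
    · simp only [h, if_false, decide_false]; rfl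
  | node _ a b iha ihb =>
    refine (PolyTime.ite hf (PolyTime.ite (iha hf.left) (ihb hf.right) .nil) .nil).congr fun x => ?_
    rcases hfx : f x with _ | ⟨_, c, d⟩
    · simp [encodeBool]
    · by_cases h1 : c = a <;> simp [h1, encodeBool_eq_nil, BinaryTree.left, BinaryTree.right] <;> rfl

/-- Every function can be tabulated on a finite set of arguments. -/
theorem exists_eqOn (F : Data → Data) (l : List Data) :
    ∃ G : Data → Data, PolyTime G ∧ ∀ x ∈ l, G x = F x := by
  induction l with
  | nil => exact ⟨_, .nil, by simp⟩
  | cons a l ih =>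
    obtain ⟨G, hG, e⟩ := ih
    refine ⟨_, ite_decide (eq_const .id a) (const (F a)) hG, fun x hx => ?_⟩
    by_cases h : x = a
    · simp [h]
    · simp [h, e x ((List.mem_cons.1 hx).resolve_left h)]

/-- A loop over the list `rest` with context `x` and accumulator `acc`. -/
theorem runs_loop_foldl {F : Data → Data → Data → Data} {p : Prog} {P : ℕ[X]}
    (hp : ∀ z, ∃ t, t ≤ P.eval z.size ∧ Runs p z (F z.left z.right.left z.right.right) t)
    (x : Data) (B : ℕ) (l : List Data) (acc : Data)
    (hB : ∀ l', l' <+: l → (l'.foldl (fun s a => F x a s) acc).size ≤ B)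
    (hl : ∀ a ∈ l, a.size ≤ B) :
    ∃ t, t ≤ l.length * (P.eval (x.size + (B + B)) + 40) + 5 ∧
      Runs (.loop (.seq .tl .hd) (.cons .hd (.cons (.seq .tl (.seq .hd .tl))
          (.seq (.cons .hd (.cons (.seq .tl (.seq .hd .hd)) (.seq .tl .tl))) p))))
        (.node () x (.node () (encodeList l) acc))
        (.node () x (.node () .nil (l.foldl (fun s a => F x a s) acc))) t := by
  induction l generalizing acc with
  | nil =>
    refine ⟨_, ?_, .loop_nil (.seq (.tl _) (.hd _))⟩
    simp
  | cons a l ih =>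
    obtain ⟨t, ht, hr⟩ := ih (F x a acc)
      (fun l' hl' => hB (a :: l') (by simpa using hl'))
      (fun b hb => hl b (List.mem_cons_of_mem _ hb))
    obtain ⟨s, hs, hr'⟩ := hp (.node () x (.node () a acc))
    have hsz : Data.size (.node () x (.node () a acc)) ≤ x.size + (B + B) := by
      have h1 := hB [] (by simp)
      have h2 := hl a (by simp)
      simp at h1 ⊢; omega
    have := hs.trans (P.eval_le_eval_of_le hsz)
    -- The loop state is the triple of context, remaining list and accumulator. The body removes the
    -- head of the list and gives context, head and accumulator to `p`. The constants 40 and 5 are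
    -- generous bounds for the overhead of a round and of the final test.
    refine ⟨_, ?_, .loop_node (.seq (.tl _) (.hd _)) (.cons (.hd _) (.cons
      (.seq (.tl _) (.seq (.hd _) (.tl _))) (.seq (.cons (.hd _) (.cons
      (.seq (.tl _) (.seq (.hd _) (.hd _))) (.seq (.tl _) (.tl _)))) hr'))) hr⟩
    simp only [List.length_cons, Nat.add_mul, Nat.one_mul]
    omega

/-- Iterating a polynomial-time step can make the accumulator grow exponentially, so `hB` asks for a
polynomial bound on every fold. Since it holds for all lists, it applies to the prefixes, that is,
to the intermediate accumulators. -/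
theorem foldl {F : Data → Data → Data → Data} (hf : PolyTime f) (hg : PolyTime g)
    (hF : PolyTime fun z => F z.left z.right.left z.right.right)
    (hB : ∃ Q : ℕ[X], ∀ x l, (List.foldl (fun s a => F x a s) (g x) l).size ≤
      Q.eval (x.size + (encodeList l).size)) :
    PolyTime fun x => (f x).toList.foldl (fun s a => F x a s) (g x) := by
  obtain ⟨p, P, hp⟩ := hf
  obtain ⟨q, Q, hq⟩ := hg
  obtain ⟨r, R, hr⟩ := hF
  obtain ⟨S, hS⟩ := hB
  -- a common bound for the accumulator and the list elements
  let B : ℕ[X] := S.comp (X + P) + P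
  refine ⟨.seq (.cons .id (.cons p q)) (.seq (.loop (.seq .tl .hd) (.cons .hd (.cons
    (.seq .tl (.seq .hd .tl)) (.seq (.cons .hd (.cons (.seq .tl (.seq .hd .hd)) (.seq .tl .tl))) r))))
    (.seq .tl .tl)), B + P + Q + 40 + P * (R.comp (X + (B + B)) + 40), fun x => ?_⟩
  obtain ⟨h1, s, hs, h2⟩ := hp x
  obtain ⟨h3, t, ht, h4⟩ := hq x
  have hpre : ∀ l', l' <+: (f x).toList → (encodeList l').size ≤ P.eval x.size := by
    rintro l' ⟨l'', e⟩
    have : (encodeList (f x).toList).size ≤ P.eval x.size := by simpa using h1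
    refine le_trans ?_ this
    rw [← e]; simp [size_encodeList]
  have hsz : ∀ l', l' <+: (f x).toList →
      (l'.foldl (fun s a => F x a s) (g x)).size ≤ B.eval x.size := by
    intro l' hl'
    refine (hS x l').trans (le_trans (S.eval_le_eval_of_le
      (Nat.add_le_add_left (hpre l' hl') _)) ?_)
    simp [B]
  have hel : ∀ a ∈ (f x).toList, a.size ≤ B.eval x.size := by
    intro a ha
    have h5 := size_le_of_mem ha
    simp only [encodeList_toList] at h5
    refine h5.trans (h1.trans ?_)
    simp [B]
  obtain ⟨u, hu, h6⟩ := runs_loop_foldl (F := F) (fun z => (hr z).2) x _ _ _ hsz hel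
  rw [encodeList_toList] at h6
  have hlen : (f x).toList.length ≤ P.eval x.size := by
    have := length_lt_size_encodeList (f x).toList
    simp only [encodeList_toList] at this
    omega
  have := Nat.mul_le_mul_right (R.eval (x.size + (B.eval x.size + B.eval x.size)) + 40) hlen
  refine ⟨?_, _, ?_, .seq (.cons (.id _) (.cons h2 h4)) (.seq h6 (.seq (.tl _) (.tl _)))⟩
  · have := hsz _ (List.prefix_refl _)
    simp only [eval_add, eval_mul, eval_comp, eval_X, eval_ofNat]
    omega
  · simp only [eval_add, eval_mul, eval_comp, eval_X, eval_ofNat]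
    omega

theorem reverse (hf : PolyTime f) : PolyTime fun x => encodeList (f x).toList.reverse := by
  have key : ∀ (l : List Data) acc, List.foldl (fun s a => Data.pair a s) acc l =
      encodeList (l.reverse ++ acc.toList) := by
    intro l
    induction l with
    | nil => intro acc; simp
    | cons a l ih => intro acc; simp [ih]
  refine (foldl (F := fun _ a s => .node () a s) (g := fun _ => .nil) hf .nil
    (PolyTime.id.right.left.pair PolyTime.id.right.right) ⟨X, fun x l => ?_⟩).congr fun x => ?_
  · rw [key]; simp [size_encodeList]
  · rw [key]; simp

theorem foldr {F : Data → Data → Data → Data} (hf : PolyTime f) (hg : PolyTime g)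
    (hF : PolyTime fun z => F z.left z.right.left z.right.right)
    (hB : ∃ Q : ℕ[X], ∀ x l, (List.foldr (F x) (g x) l).size ≤
      Q.eval (x.size + (encodeList l).size)) :
    PolyTime fun x => (f x).toList.foldr (F x) (g x) := by
  obtain ⟨Q, hQ⟩ := hB
  refine (foldl (F := F) hf.reverse hg hF ⟨Q, fun x l => ?_⟩).congr fun x => ?_
  · rw [← List.foldr_reverse]
    simpa [size_encodeList] using hQ x l.reverse
  · simp [List.foldl_reverse]

theorem map {F : Data → Data → Data} (hf : PolyTime f)
    (hF : PolyTime fun z => F z.left z.right) :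
    PolyTime fun x => encodeList ((f x).toList.map (F x)) := by
  have key : ∀ x (l : List Data), List.foldr (fun a s => Data.pair (F x a) s) .nil l =
      encodeList (l.map (F x)) := by
    intro x l
    induction l with
    | nil => simp [encodeList]
    | cons a l ih => simp [ih, encodeList]
  obtain ⟨p, P, hp⟩ := id hF
  refine (foldr (F := fun x a s => .node () (F x a) s) (g := fun _ => .nil) hf .nil
    ((hF.comp (PolyTime.id.left.pair PolyTime.id.right.left)).pair PolyTime.id.right.right)
    ⟨X * P + 1, fun x l => ?_⟩).congr fun x => ?_
  · rw [key, size_encodeList, List.map_map]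
    have h1 : ∀ n ∈ l.map (Data.size ∘ F x), n ≤ P.eval (x.size + (encodeList l).size) := by
      simp only [List.mem_map, Function.comp]
      rintro _ ⟨a, ha, rfl⟩
      refine (hp (.node () x a)).1.trans (P.eval_le_eval_of_le ?_)
      have := size_le_of_mem ha
      simp; omega
    have h2 := List.sum_le_card_nsmul _ _ h1
    have h3 := length_lt_size_encodeList l
    simp only [List.length_map, smul_eq_mul] at h2
    simp only [eval_add, eval_mul, eval_X, eval_one]
    have := Nat.mul_le_mul_right (P.eval (x.size + (encodeList l).size))
      (show l.length ≤ x.size + (encodeList l).size by omega)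
    omega
  · exact key _ _

theorem append (hf : PolyTime f) (hg : PolyTime g) :
    PolyTime fun x => encodeList ((f x).toList ++ (g x).toList) := by
  have key : ∀ (l : List Data) (y : Data), List.foldr (fun a s => Data.pair a s) y l =
      encodeList (l ++ toList y) := by
    intro l y
    induction l with
    | nil => simp
    | cons a l ih => simp [ih, encodeList]
  obtain ⟨p, P, hp⟩ := id hg
  refine (foldr (F := fun _ a s => .node () a s) hf hg
    (PolyTime.id.right.left.pair PolyTime.id.right.right) ⟨X + P, fun x l => ?_⟩).congr fun x => ?_
  · rw [key]
    have h1 := (hp x).1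
    have h2 := P.eval_le_eval_of_le (Nat.le_add_right x.size (encodeList l).size)
    have h3 : (encodeList (l ++ (g x).toList)).size + 1 = (encodeList l).size + (g x).size := by
      conv_rhs => rw [← encodeList_toList (g x)]
      simp only [size_encodeList, List.map_append, List.sum_append]; omega
    simp; omega
  · exact key _ _

theorem flatMap {F : Data → Data → Data} (hf : PolyTime f)
    (hF : PolyTime fun z => F z.left z.right) :
    PolyTime fun x => encodeList ((f x).toList.flatMap fun a => (F x a).toList) := by
  have key : ∀ x (l : List Data),
      List.foldr (fun a s => encodeList ((F x a).toList ++ s.toList)) .nil l =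
      encodeList (l.flatMap fun a => (F x a).toList) := by
    intro x l
    induction l with
    | nil => simp [encodeList]
    | cons a l ih => simp [ih]
  obtain ⟨p, P, hp⟩ := id hF
  refine (foldr (F := fun x a s => encodeList ((F x a).toList ++ s.toList)) (g := fun _ => .nil)
    hf .nil (append (hF.comp (PolyTime.id.left.pair PolyTime.id.right.left)) PolyTime.id.right.right)
    ⟨X * P + 1, fun x l => ?_⟩).congr fun x => ?_
  · rw [key]
    have h0 : ∀ l' : List Data, (encodeList (l'.flatMap fun a => (F x a).toList)).size ≤
        (l'.map fun a => (F x a).size).sum + 1 := by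
      intro l'
      induction l' with
      | nil => simp [encodeList]
      | cons a l' ih =>
        simp only [size_encodeList, List.flatMap_cons, List.map_append, List.sum_append,
          List.map_cons, List.sum_cons] at ih ⊢
        have := size_encodeList (F x a).toList
        rw [encodeList_toList] at this
        omega
    have h1 : ∀ n ∈ l.map (fun a => (F x a).size), n ≤ P.eval (x.size + (encodeList l).size) := by
      simp only [List.mem_map]
      rintro _ ⟨a, ha, rfl⟩
      refine (hp (.node () x a)).1.trans (P.eval_le_eval_of_le ?_)
      have := size_le_of_mem ha
      simp; omega
    have h2 := List.sum_le_card_nsmul _ _ h1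
    have h3 := length_lt_size_encodeList l
    simp only [List.length_map, smul_eq_mul] at h2
    simp only [eval_add, eval_mul, eval_X, eval_one]
    have := Nat.mul_le_mul_right (P.eval (x.size + (encodeList l).size))
      (show l.length ≤ x.size + (encodeList l).size by omega)
    have := h0 l
    omega
  · exact key _ _

/-- The list of all nonempty suffixes of a list. -/
def _root_.Data.suffixes (l : List Data) : List Data :=
  (List.range l.length).map fun k => encodeList (l.drop k)

/-- Suffixes serve as positions: the length of a suffix is a unary counter, and its head is the
entry at that position. While folding from the right, the first component of the accumulator is
always the suffix found last. -/
theorem suffixes (hf : PolyTime f) : PolyTime fun x => encodeList (Data.suffixes (f x).toList) := by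
  have key : ∀ l : List Data,
      List.foldr (fun a s => Data.pair (Data.pair a s.left) s) .nil l =
        encodeList (Data.suffixes l) := by
    intro l
    induction l with
    | nil => simp [Data.suffixes, encodeList]
    | cons a l ih =>
      rw [List.foldr_cons, ih]
      have : (encodeList (Data.suffixes l)).left = encodeList l := by
        cases l <;> simp [Data.suffixes, encodeList, BinaryTree.left, List.range_succ_eq_map]
      rw [this]
      simp [Data.suffixes, encodeList, List.range_succ_eq_map, Function.comp_def]
  refine (foldr (F := fun _ a s => .node () (.node () a s.left) s) (g := fun _ => .nil) hf .nil
    ((PolyTime.id.right.left.pair PolyTime.id.right.right.left).pair PolyTime.id.right.right)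
    ⟨X * X + 1, fun x l => ?_⟩).congr fun x => ?_
  · rw [key, size_encodeList, Data.suffixes, List.map_map]
    have h1 : ∀ n ∈ (List.range l.length).map (Data.size ∘ fun k => encodeList (l.drop k)),
        n ≤ x.size + (encodeList l).size := by
      simp only [List.mem_map, Function.comp]
      rintro _ ⟨k, -, rfl⟩
      have := (List.drop_suffix k l).sublist.map Data.size |>.sum_le_sum (by simp)
      simp only [size_encodeList]
      omega
    have h2 := List.sum_le_card_nsmul _ _ h1
    have h3 := length_lt_size_encodeList l
    simp only [List.length_map, smul_eq_mul, List.length_range] at h2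
    simp only [eval_add, eval_mul, eval_X, eval_one]
    have := Nat.mul_le_mul_right (x.size + (encodeList l).size)
      (show l.length ≤ x.size + (encodeList l).size by omega)
    omega
  · exact key _

/-- Dropping from `g x` as many elements as `f x` has. -/
theorem drop (hf : PolyTime f) (hg : PolyTime g) :
    PolyTime fun x => encodeList ((g x).toList.drop (f x).toList.length) := by
  have key : ∀ (l : List Data) (y : Data), List.foldr (fun _ s => BinaryTree.right s) y l =
      encodeList ((toList y).drop l.length) := by
    intro l y
    induction l with
    | nil => simp
    | cons a l ih =>
      rw [List.foldr_cons, ih, List.length_cons, ← List.tail_drop]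
      cases (toList y).drop l.length <;> simp [encodeList, BinaryTree.right]
  obtain ⟨p, P, hp⟩ := id hg
  refine (foldr (F := fun _ _ s => s.right) hf hg PolyTime.id.right.right.right
    ⟨P, fun x l => ?_⟩).congr fun x => ?_
  · rw [key, size_encodeList]
    have h1 := (hp x).1
    have h2 := P.eval_le_eval_of_le (Nat.le_add_right x.size (encodeList l).size)
    have h3 := (List.drop_suffix l.length (g x).toList).sublist.map Data.size |>.sum_le_sum (by simp)
    have h4 := size_encodeList (g x).toList
    rw [encodeList_toList] at h4
    omega
  · exact key _ _

/-- Two lists have equal lengths iff dropping the length of either from the other leaves nothing. -/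
theorem length_eq (hf : PolyTime f) (hg : PolyTime g) :
    PolyTime fun x => encodeBool (decide ((f x).toList.length = (g x).toList.length)) := by
  refine (PolyTime.ite (drop hf hg) .nil (PolyTime.ite (drop hg hf) .nil
    (const (encodeBool true)))).congr fun x => ?_
  have key : ∀ l : List Data, encodeList l = .nil ↔ l = [] := by
    intro l; cases l <;> simp [encodeList]
  simp only [key, List.drop_eq_nil_iff]
  by_cases h : (f x).toList.length = (g x).toList.length
  · simp [h]
  · have : ¬ ((g x).toList.length ≤ (f x).toList.length ∧
      (f x).toList.length ≤ (g x).toList.length) := by omega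
    rw [not_and_or] at this
    rcases this with h' | h' <;> simp [h, h', encodeBool]

@[simp] theorem _root_.Data.encodeNat_succ (n : ℕ) :
    encodeNat (n + 1) = Data.pair .nil (encodeNat n) := by
  simp [encodeNat, List.replicate_succ, encodeList]

@[simp] theorem _root_.Data.toList_encodeNat (n : ℕ) :
    (encodeNat n).toList = List.replicate n .nil := by simp [encodeNat]

@[simp] theorem _root_.Data.size_encodeNat (n : ℕ) : (encodeNat n).size = n + 1 := by
  simp [encodeNat, size_encodeList]

/-- Division with remainder by a constant, for numbers in unary. -/
theorem divMod {a : ℕ} (ha : 0 < a) (hf : PolyTime f) :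
    PolyTime fun x => Data.pair (encodeNat ((f x).toList.length / a))
      (encodeNat ((f x).toList.length % a)) := by
  -- The accumulator is the pair of quotient and remainder; a remainder of `a - 1` wraps to zero and
  -- increases the quotient.
  have key : ∀ l : List Data,
      List.foldr (fun _ s => if s.right = encodeNat (a - 1) then
        Data.pair (Data.pair .nil s.left) .nil else Data.pair s.left (Data.pair .nil s.right))
        (Data.pair .nil .nil) l = Data.pair (encodeNat (l.length / a)) (encodeNat (l.length % a)) := by
    intro l
    have hz : encodeNat 0 = .nil := rfl
    induction l with
    | nil => simp [hz]
    | cons b l ih =>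
      rw [List.foldr_cons, ih]
      have hinj : ∀ m n : ℕ, encodeNat m = encodeNat n ↔ m = n := by
        intro m n
        refine ⟨fun h => ?_, fun h => h ▸ rfl⟩
        have := congrArg Data.size h
        simpa using this
      simp only [BinaryTree.right, BinaryTree.left, hinj, List.length_cons]
      have hm := Nat.mod_lt l.length ha
      have hd := Nat.div_add_mod l.length a
      by_cases h : l.length % a = a - 1
      · have h1 : l.length + 1 = a * (l.length / a + 1) := by rw [Nat.mul_add]; omega
        have h2 : (l.length + 1) / a = l.length / a + 1 := by rw [h1, Nat.mul_div_cancel_left _ ha]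
        have h3 : (l.length + 1) % a = 0 := by rw [h1, Nat.mul_mod_right]
        rw [if_pos h, h2, h3, encodeNat_succ, hz]
      · have h1 : l.length + 1 = (l.length % a + 1) + a * (l.length / a) := by omega
        have h2 : (l.length + 1) / a = l.length / a := by
          rw [h1, Nat.add_mul_div_left _ _ ha, Nat.div_eq_of_lt (by omega), zero_add]
        have h3 : (l.length + 1) % a = l.length % a + 1 := by
          rw [h1, Nat.add_mul_mod_self_left, Nat.mod_eq_of_lt (by omega)]
        rw [if_neg h, h2, h3, encodeNat_succ]
  have hs := PolyTime.id.right.right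
  refine (foldr (F := fun _ _ s => if s.right = encodeNat (a - 1) then
        Data.pair (Data.pair .nil s.left) .nil else Data.pair s.left (Data.pair .nil s.right))
    hf (const (Data.pair .nil .nil)) ?_ ⟨X + C 2, fun x l => ?_⟩).congr fun x => key _
  · refine ite_decide (eq_const hs.right (encodeNat (a - 1)))
      ((PolyTime.nil.pair hs.left).pair .nil) (hs.left.pair (PolyTime.nil.pair hs.right))
  · rw [key]
    have h1 := length_lt_size_encodeList l
    have h2 := Nat.div_le_self l.length a
    have h4 := Nat.div_add_mod l.length a
    have h5 : l.length / a ≤ a * (l.length / a) := Nat.le_mul_of_pos_left _ ha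
    simp; omega

end PolyTime

/-! ### Building graphs by clique-width expressions -/

/-- The subgraph of `G` induced by `s`, with the labels given by `lab`, is defined by some
clique-width expression with labels in `K`. -/
def CWBuilt {V K : Type*} [Fintype K] (G : SimpleGraph V) (lab : V → K) (s : Set V) : Prop :=
  ∃ (a : CWExpr (Fintype.card K)) (e : a.Vert → V), Function.Injective e ∧ Set.range e = s ∧
    (∀ x y, a.graph.Adj x y ↔ G.Adj (e x) (e y)) ∧
    ∀ x, a.label x = Fintype.equivFin K (lab (e x))

namespace CWBuilt

variable {V K : Type*} [Fintype K] {G G' : SimpleGraph V} {lab lab' : V → K} {s : Set V}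

theorem congr (h : CWBuilt G lab s) (hG : ∀ v ∈ s, ∀ w ∈ s, G.Adj v w ↔ G'.Adj v w)
    (hl : ∀ v ∈ s, lab v = lab' v) : CWBuilt G' lab' s := by
  obtain ⟨a, e, hi, rfl, h1, h2⟩ := h
  refine ⟨a, e, hi, rfl, fun x y => ?_, fun x => ?_⟩
  · rw [h1, hG _ ⟨x, rfl⟩ _ ⟨y, rfl⟩]
  · rw [h2, hl _ ⟨x, rfl⟩]

theorem singleton (G : SimpleGraph V) (lab : V → K) (v : V) : CWBuilt G lab {v} := by
  refine ⟨.vertex (Fintype.equivFin K (lab v)), fun _ => v, fun x y _ => ?_, ?_, ?_, fun _ => rfl⟩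
  · cases x; cases y; rfl
  · ext w
    constructor
    · rintro ⟨_, rfl⟩; rfl
    · rintro rfl; exact ⟨Unit.unit, rfl⟩
  · intro x y
    simp only [SimpleGraph.irrefl, iff_false]
    exact fun h => h

theorem relabel [DecidableEq K] (h : CWBuilt G lab s) (i j : K) :
    CWBuilt G (fun v => if lab v = i then j else lab v) s := by
  obtain ⟨a, e, hi, rfl, h1, h2⟩ := h
  refine ⟨.relabel (Fintype.equivFin K i) (Fintype.equivFin K j) a, e, hi, rfl, h1,
    fun (x : a.Vert) => ?_⟩
  have : (if a.label x = Fintype.equivFin K i then Fintype.equivFin K j else a.label x) =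
      Fintype.equivFin K (if lab (e x) = i then j else lab (e x)) := ?_
  · exact this
  rw [h2]
  by_cases h : lab (e x) = i <;> simp [h]

theorem join (h : CWBuilt G lab s) {i j : K} (hij : i ≠ j) :
    CWBuilt (G ⊔ SimpleGraph.fromRel fun v w => lab v = i ∧ lab w = j) lab s := by
  obtain ⟨a, e, hi, rfl, h1, h2⟩ := h
  refine ⟨.join (Fintype.equivFin K i) (Fintype.equivFin K j) (by simpa using hij) a, e, hi, rfl,
    fun (x y : a.Vert) => ?_, h2⟩
  have : (a.graph ⊔ SimpleGraph.fromRel fun u v => a.label u = Fintype.equivFin K i ∧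
      a.label v = Fintype.equivFin K j).Adj x y ↔
      (G ⊔ SimpleGraph.fromRel fun v w => lab v = i ∧ lab w = j).Adj (e x) (e y) := ?_
  · exact this
  simp only [SimpleGraph.sup_adj, SimpleGraph.fromRel_adj, h1, h2, hi.ne_iff,
    EmbeddingLike.apply_eq_iff_eq]

theorem union_singleton (h : CWBuilt G lab s) {v : V} (hv : v ∉ s)
    (hG : ∀ w ∈ s, ¬ G.Adj v w) : CWBuilt G lab (insert v s) := by
  obtain ⟨a, e, hi, rfl, h1, h2⟩ := h
  refine ⟨.union a (.vertex (Fintype.equivFin K (lab v))), Sum.elim e fun _ => v, ?_, ?_, ?_, ?_⟩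
  · exact hi.sumElim (fun x y _ => by cases x; cases y; rfl) fun x _ e' => hv ⟨x, e'⟩
  · ext w
    constructor
    · rintro ⟨x | x, rfl⟩
      · exact Or.inr ⟨x, rfl⟩
      · exact Or.inl rfl
    · rintro (rfl | ⟨x, rfl⟩)
      · exact ⟨Sum.inr Unit.unit, rfl⟩
      · exact ⟨Sum.inl x, rfl⟩
  · rintro (x | x) (y | y)
    · exact h1 x y
    · exact ⟨fun h => (Bool.false_ne_true h).elim, fun h => (hG _ ⟨x, rfl⟩ h.symm).elim⟩
    · exact ⟨fun h => (Bool.false_ne_true h).elim, fun h => (hG _ ⟨y, rfl⟩ h).elim⟩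
    · exact ⟨fun h => h.elim, fun h => (G.irrefl h).elim⟩
  · rintro (x | x)
    · exact h2 x
    · rfl

theorem collapse [DecidableEq K] (h : CWBuilt G lab s) (J : Finset K) (j : K) :
    CWBuilt G (fun v => if lab v ∈ J then j else lab v) s := by
  induction J using Finset.induction_on with
  | empty => simpa using h
  | insert i J _ ih =>
    -- Relabelling `j` to itself changes nothing, so this case needs no operation.
    by_cases hj : j = i
    · refine ih.congr (fun _ _ _ _ => Iff.rfl) fun v _ => ?_
      by_cases h1 : lab v ∈ J <;> by_cases h2 : lab v = i <;> simp [h1, h2, hj]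
    · refine (ih.relabel i j).congr (fun _ _ _ _ => Iff.rfl) fun v _ => ?_
      simp only [Finset.mem_insert]
      grind

/-- A vertex can be added if its neighbours are determined by their labels, provided that there is
a free label. -/
theorem insert_vertex (h : CWBuilt G lab s) {v : V} (hv : v ∉ s) {new : K}
    (hnew : ∀ w ∈ s, lab w ≠ new) {L : Set K} (hL : ∀ w ∈ s, G.Adj v w ↔ lab w ∈ L) :
    CWBuilt G lab (insert v s) := by
  classical
  -- The final label of `v` may already be used in `s`. So `v` enters with the free label `new`, is
  -- joined to the labels in `L` one at a time, and is relabelled at the end.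
  let lab₀ : V → K := Function.update lab v new
  have hlab : ∀ w ∈ s, lab₀ w = lab w := fun w hw =>
    Function.update_of_ne (by rintro rfl; exact hv hw) _ _
  have hlabv : lab₀ v = new := Function.update_self ..
  -- the graph in which `v` is joined to the labels in `J` only
  let F : Finset K → SimpleGraph V := fun J =>
    { Adj := fun x y => G.Adj x y ∧ (x = v → lab y ∈ J) ∧ (y = v → lab x ∈ J)
      symm := ⟨fun x y h => ⟨h.1.symm, h.2.2, h.2.1⟩⟩
      loopless := ⟨fun x h => G.loopless.1 x h.1⟩ }
  have key : ∀ J : Finset K, CWBuilt (F J) lab₀ (insert v s) := by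
    intro J
    induction J using Finset.induction_on with
    | empty =>
      refine union_singleton (h.congr (fun x hx y hy => ?_) fun x hx => (hlab x hx).symm) hv ?_
      · have h1 : x ≠ v := by rintro rfl; exact hv hx
        have h2 : y ≠ v := by rintro rfl; exact hv hy
        simp [F, h1, h2]
      · simp [F]
    | insert i J _ ih =>
      by_cases hi : i ∈ L ∧ i ≠ new
      · refine (ih.join hi.2).congr (fun x hx y hy => ?_) fun _ _ => rfl
        simp only [SimpleGraph.sup_adj, SimpleGraph.fromRel_adj, F, Finset.mem_insert]
        rcases Set.mem_insert_iff.1 hx with rfl | hx' <;>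
          rcases Set.mem_insert_iff.1 hy with rfl | hy'
        · simp
        · have h2 : y ≠ x := by rintro rfl; exact hv hy'
          rw [hlabv, hlab y hy', hL y hy']
          have := hnew y hy'
          have h4 := h2.symm
          by_cases h3 : lab y = i <;> simp_all
        · have h2 : x ≠ y := by rintro rfl; exact hv hx'
          rw [hlabv, hlab x hx', G.adj_comm, hL x hx']
          have := hnew x hx'
          have h4 := h2.symm
          by_cases h3 : lab x = i <;> simp_all
        · have h1 : x ≠ v := by rintro rfl; exact hv hx'
          have h2 : y ≠ v := by rintro rfl; exact hv hy'
          rw [hlab x hx', hlab y hy']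
          simp [h1, h2, hnew x hx', hnew y hy']
      -- Either no vertex of `s` labelled `i` is a neighbour of `v`, or `i = new` is not used in
      -- `s`; in both cases no join is needed.
      · refine ih.congr (fun x hx y hy => ?_) fun _ _ => rfl
        simp only [F, Finset.mem_insert]
        have aux : ∀ y ∈ s, G.Adj v y → lab y ≠ i := by
          rintro y hy hvy rfl
          exact hi ⟨(hL y hy).1 hvy, hnew y hy⟩
        rcases Set.mem_insert_iff.1 hx with rfl | hx' <;>
          rcases Set.mem_insert_iff.1 hy with rfl | hy'
        · simp
        · have h2 : y ≠ x := by rintro rfl; exact hv hy'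
          have := aux y hy'
          simp only [h2, true_imp_iff, false_imp_iff, and_true]
          grind
        · have h2 : x ≠ y := by rintro rfl; exact hv hx'
          have := aux x hx'
          rw [G.adj_comm] at this
          simp only [h2, true_imp_iff, false_imp_iff, true_and]
          grind
        · have h1 : x ≠ v := by rintro rfl; exact hv hx'
          have h2 : y ≠ v := by rintro rfl; exact hv hy'
          simp [h1, h2]
  refine ((key Finset.univ).relabel new (lab v)).congr (fun x _ y _ => by simp [F]) ?_
  intro w hw
  rcases Set.mem_insert_iff.1 hw with rfl | hw
  · simp [hlabv]
  · simp [hlab w hw, hnew w hw]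

theorem cliqueWidth_le (h : CWBuilt G lab Set.univ) : cliqueWidth G ≤ Fintype.card K := by
  obtain ⟨a, e, hi, hr, h1, -⟩ := h
  refine Nat.sInf_le ⟨a, ⟨⟨Equiv.ofBijective e ⟨hi, Set.range_eq_univ.1 hr⟩, ?_⟩⟩⟩
  intro x y
  exact (h1 x y).symm

end CWBuilt

theorem cliqueWidth_congr {V W : Type*} {G : SimpleGraph V} {G' : SimpleGraph W} (e : G ≃g G') :
    cliqueWidth G = cliqueWidth G' := by
  unfold cliqueWidth
  congr 1
  ext k
  exact ⟨fun ⟨a, ⟨f⟩⟩ => ⟨a, ⟨f.trans e⟩⟩, fun ⟨a, ⟨f⟩⟩ => ⟨a, ⟨f.trans e.symm⟩⟩⟩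

/-! ### Cores, thinness, signature sets and projectivity -/

namespace LoopGraph

/-- Distinct vertices have incomparable neighbourhoods. -/
def IsThin {V : Type*} (H : LoopGraph V) : Prop :=
  ∀ u w, (∀ v, H.Adj u v → H.Adj w v) → u = w

/-- If `N(u) ⊆ N(w)`, then moving `u` to `w` and fixing all else is an endomorphism, as `u` has no
loop. In a core it is injective, so `u = w`. -/
theorem IsCore.isThin {V : Type*} {H : LoopGraph V} (hH : H.IsCore) (hloop : ∀ v, ¬ H.Adj v v) :
    H.IsThin := by
  classical
  intro u w h
  obtain ⟨e, he⟩ := hH ⟨fun v => if v = u then w else v, by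
    intro a b hab
    by_cases ha : a = u
    · subst ha
      have hb : b ≠ a := by rintro rfl; exact hloop _ hab
      simpa [hb] using h b hab
    · by_cases hb : b = u
      · subst hb
        simpa [ha] using H.symm (h a (H.symm hab))
      · simpa [ha, hb] using hab⟩
  apply e.injective
  rw [he, he]
  by_cases hw : w = u <;> simp [hw]

/-- A graph is trivial if it has a homomorphism to a subgraph induced by a single vertex. -/
theorem isTrivial_of_hom_singleton {V : Type*} {H : LoopGraph V} (v : V)
    (f : H.Adj →r (H.induce {v}).Adj) : H.IsTrivial :=
  ⟨{v}, Set.finite_singleton v, by simp, fun f => ⟨RelIso.refl _, fun w => Subsingleton.elim _ _⟩,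
    ⟨f⟩⟩

theorem not_adj_self_of_not_isTrivial {V : Type*} {H : LoopGraph V} (h : ¬ H.IsTrivial) (v : V) :
    ¬ H.Adj v v :=
  fun hv => h (isTrivial_of_hom_singleton v ⟨fun _ => ⟨v, rfl⟩, fun _ => hv⟩)

theorem exists_adj_of_not_isTrivial {V : Type*} {H : LoopGraph V} (h : ¬ H.IsTrivial) :
    ∃ v w, H.Adj v w := by
  by_contra! hno
  rcases isEmpty_or_nonempty V with hV | ⟨⟨v⟩⟩
  · exact h ⟨∅, Set.finite_empty, by simp, fun f => ⟨RelIso.refl _, fun w => w.2.elim⟩,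
      ⟨⟨fun v => hV.elim v, fun {a} => hV.elim a⟩⟩⟩
  · exact h (isTrivial_of_hom_singleton v ⟨fun _ => ⟨v, rfl⟩, fun {a b} hab => (hno a b hab).elim⟩)

/-- The neighbourhood of an isolated vertex is contained in every other one. -/
theorem IsThin.exists_adj {V : Type*} {H : LoopGraph V} (hH : H.IsThin)
    (he : ∃ v w, H.Adj v w) (u : V) : ∃ w, H.Adj u w := by
  by_contra! hno
  obtain ⟨v, w, hvw⟩ := he
  have := hH u v fun x hx => (hno x hx).elim
  subst this
  exact hno w hvw

variable {X Y : Type*} {A : LoopGraph X} {B : LoopGraph Y}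

theorem IsThin.of_prod (h : (A.prod B).IsThin) (y : Y) : A.IsThin := by
  intro u w huw
  exact congrArg Prod.fst (h (u, y) (w, y) fun v hv => ⟨huw _ hv.1, hv.2⟩)

theorem IsCore.congr {V W : Type*} {H : LoopGraph V} {K : LoopGraph W} (hH : H.IsCore)
    (e : H.Adj ≃r K.Adj) : K.IsCore := by
  intro f
  obtain ⟨g, hg⟩ := hH ((e.symm : K.Adj →r H.Adj).comp (f.comp (e : H.Adj →r K.Adj)))
  refine ⟨(e.symm.trans g).trans e, fun v => ?_⟩
  have := hg (e.symm v)
  simp only [RelIso.trans_apply, this]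
  simp

/-- The neighbourhoods `S({x})` are already pairwise distinct signature sets. This is used to see
that the signature number is at least 2. -/
theorem IsThin.card_le_signatureNumber [Finite X] (hA : A.IsThin) (he : ∀ u, ∃ w, A.Adj u w) :
    Nat.card X ≤ A.signatureNumber := by
  have hinj : Function.Injective fun x : X => A.signature {x} := by
    intro u w huw
    refine hA u w fun v hv => ?_
    have : v ∈ A.signature {u} := by rintro _ rfl; exact hv
    change A.signature {u} = A.signature {w} at huw
    rw [huw] at this
    exact this w rfl
  rw [← Set.ncard_univ, ← Set.ncard_image_of_injective _ hinj]
  refine Set.ncard_le_ncard ?_ (Set.toFinite _)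
  rintro _ ⟨x, -, rfl⟩
  obtain ⟨w, hw⟩ := he x
  exact ⟨⟨w, by rintro _ rfl; exact hw⟩, {x}, Set.singleton_nonempty x, rfl⟩

theorem signature_nonempty_of_mem {S : Set X} (hS : S ∈ A.signatureSets) :
    (A.signature S).Nonempty := by
  obtain ⟨-, T, ⟨t, ht⟩, rfl⟩ := hS
  exact ⟨t, fun v hv => A.symm (hv t ht)⟩

/-- Signature sets are the closed sets of the Galois connection given by adjacency. This turns
complete adjacency to `S(T)` into membership in `T`. -/
theorem signature_signature {S : Set X} (hS : S ∈ A.signatureSets) :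
    A.signature (A.signature S) ⊆ S := by
  obtain ⟨-, T, -, rfl⟩ := hS
  intro v hv t ht
  exact hv t fun w hw => A.symm (hw t ht)

/-- A factor of a product is projective if the homomorphisms from the product of one of its powers
and the other factors to it that are idempotent are projections. -/
def ProjectiveFactor (A : LoopGraph X) (B : LoopGraph Y) (D : Type*) : Prop :=
  ∀ f : (((pi fun _ : D => A).prod B).Adj →r A.Adj), (∀ x y, f (fun _ => x, y) = x) →
    ∃ d : D, ∀ x y, f (x, y) = x d

/-- Projectivity is transported along a bijection between `D` and `Fin (Nat.card D)`, so that the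
coordinates may be indexed by block states. -/
theorem IsProjectiveAt.projectiveFactor {m : ℕ} {W : Fin m → Type*} {F : ∀ i, LoopGraph (W i)}
    {i : Fin m} (h : IsProjectiveAt F i) (D : Type*) [Finite D] (hD : 2 ≤ Nat.card D) :
    (F i).ProjectiveFactor (pi fun j : {j : Fin m // j ≠ i} => F j) D := by
  intro f hf
  obtain ⟨q, hq⟩ := h.2 (Nat.card D) hD ⟨fun z => f (fun d => z.1 (Finite.equivFin D d), z.2),
    fun {a b} hab => f.map_rel ⟨fun d => hab.1 _, hab.2⟩⟩ (fun x y => hf x y)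
  refine ⟨(Finite.equivFin D).symm q, fun x y => ?_⟩
  have := hq (fun k => x ((Finite.equivFin D).symm k)) y
  simpa using this

/-- Splitting off one factor of a product. -/
def piSplitIso {m : ℕ} {W : Fin m → Type*} (F : ∀ i, LoopGraph (W i)) (i : Fin m) :
    (pi F).Adj ≃r ((F i).prod (pi fun j : {j : Fin m // j ≠ i} => F j)).Adj where
  toEquiv := Equiv.piSplitAt i W
  map_rel_iff' := by
    intro a b
    constructor
    · intro h j
      by_cases hj : j = i
      · subst hj; exact h.1
      · exact h.2 ⟨j, hj⟩
    · intro h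
      exact ⟨h i, fun j => h j⟩

end LoopGraph

/-! ### Layered graphs -/

/-- The finite tables from which a layered graph is built. Every layer has a type in `Λ`; its
vertices are the elements of `Γ` and of `S × E`. -/
structure LayerScheme (Λ Γ S E : Type*) where
  /-- the edges inside of a layer -/
  inner : Γ → Γ → Prop
  symm : ∀ ⦃x y⦄, inner x y → inner y x
  irrefl : ∀ x, ¬ inner x x
  /-- the edges between a layer and the next one -/
  next : Λ → Γ → Λ → Γ → Prop
  /-- the edges between the vertices in `S × E` and those in `Γ` of the same layer -/
  port : S × E → Γ → Prop
  /-- the edges between the vertices in `S × E` of a layer and those in `Γ` of a later layer -/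
  carry : S → Γ → Prop

namespace LayerScheme

variable {Λ Γ S E : Type*} (𝓢 : LayerScheme Λ Γ S E)

/-- The directed edges of the layered graph. -/
def Arc (nb : ℕ) (ty : ℕ → Λ) : ℕ × (Γ ⊕ S × E) → ℕ × (Γ ⊕ S × E) → Prop
  | (t, .inl x), (t', .inl y) => (t = t' ∧ 𝓢.inner x y) ∨ (t' = t + 1 ∧ 𝓢.next (ty t) x (ty t') y)
  | (t, .inr q), (t', .inl y) => (t = t' ∧ 𝓢.port q y) ∨ (t' = t + nb ∧ 𝓢.carry q.1 y)
  | (_, _), (_, .inr _) => False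

theorem not_arc_self (nb : ℕ) (ty : ℕ → Λ) (u : ℕ × (Γ ⊕ S × E)) : ¬ 𝓢.Arc nb ty u u := by
  obtain ⟨t, x | q⟩ := u
  · simp [Arc, 𝓢.irrefl]
  · simp [Arc]

/-- The layered graph with `M` layers of the types `ty 0, …, ty (M - 1)`. -/
def graph (nb : ℕ) (ty : ℕ → Λ) (M : ℕ) : SimpleGraph (Fin M × (Γ ⊕ S × E)) where
  Adj u v := 𝓢.Arc nb ty (u.1, u.2) (v.1, v.2) ∨ 𝓢.Arc nb ty (v.1, v.2) (u.1, u.2)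
  symm := ⟨fun _ _ h => h.symm⟩
  loopless := ⟨fun _ h => 𝓢.not_arc_self _ _ _ (or_self_iff.1 h)⟩

end LayerScheme

/-! ### Homomorphisms of layered graphs as choices of one state per layer -/

namespace LoopGraph

/-- A map onto a nonempty set that fixes its elements. -/
noncomputable def pick {X : Type*} (Z : Set X) (x : X) : X :=
  open Classical in if x ∈ Z then x else if h : Z.Nonempty then h.some else x

theorem pick_of_mem {X : Type*} {Z : Set X} {x : X} (h : x ∈ Z) : pick Z x = x := by
  simp [pick, h]

theorem pick_mem {X : Type*} {Z : Set X} (h : Z.Nonempty) (x : X) : pick Z x ∈ Z := by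
  unfold pick
  split_ifs with h1
  · exact h1
  · exact h.some_mem

variable {X Y D Λ S : Type*}

/-- The layers of this scheme are copies of `A ^ D × B`. The homomorphisms to `A × B` choose an
element of `D` in each layer; this gives a colour passed to the next layer, and for each element of
`S` a signature set passed to a later layer. -/
noncomputable def homScheme (A : LoopGraph X) (hA : ∀ x, ¬ A.Adj x x) (B : LoopGraph Y)
    [Nonempty D] (val : D → S → A.signatureSets) (inC outC : Λ → D → X) (y₀ y₁ : Y) :
    LayerScheme Λ ((D → X) × Y) S X where
  inner := ((pi fun _ : D => A).prod B).Adj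
  symm := ((pi fun _ : D => A).prod B).symm
  irrefl _ h := hA _ (h.1 (Classical.arbitrary D))
  -- The first kind of edge links the diagonals of consecutive layers. In the second kind, as `e`
  -- runs through `X`, coordinate `d` of the left end runs through all neighbours of `outC l d`,
  -- which will force `inC l'` to take the same colour.
  next l u l' v :=
    (∃ x y x' y', u = (fun _ => x, y) ∧ v = (fun _ => x', y') ∧ A.Adj x x' ∧ B.Adj y y') ∨
    (∃ e, u = (fun d => pick (A.signature {outC l d}) e, y₁) ∧ v = (inC l', y₀))
  -- A port `(p, e)` has the neighbours inside its layer that the displayed tuple has. The edges of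
  -- `carry` depend on `p` but not on `e`; this is what keeps the clique-width small.
  port q v := ((pi fun _ : D => A).prod B).Adj (fun d => pick (A.signature (val d q.1)) q.2, y₁) v
  carry p v := ∃ e, v = (fun d => pick (val d p : Set X) e, y₀)

variable {A : LoopGraph X} {hA : ∀ x, ¬ A.Adj x x} {B : LoopGraph Y} [Nonempty D]
  {val : D → S → A.signatureSets} {inC outC : Λ → D → X} {y₀ y₁ : Y} {nb M : ℕ} {ty : ℕ → Λ}

/-- The `A`-coordinates alone carry the information; off the diagonals, the `B`-coordinates of the
images play no role. -/
theorem exists_choice_of_hom (hcore : (A.prod B).IsCore) (hthin : (A.prod B).IsThin)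
    (hne : ∀ x, ∃ y, A.Adj x y) (hproj : A.ProjectiveFactor B D) (hy : B.Adj y₀ y₁)
    (φ : ((homScheme A hA B val inC outC y₀ y₁).graph nb ty M).Adj →r (A.prod B).Adj) :
    ∃ d : ℕ → D, (∀ t, t + 1 < M → inC (ty (t + 1)) (d (t + 1)) = outC (ty t) (d t)) ∧
      ∀ t p, t + nb < M → (val (d (t + nb)) p : Set X) ⊆ val (d t) p := by
  classical
  rcases Nat.eq_zero_or_pos M with rfl | hM
  · exact ⟨fun _ => Classical.arbitrary D, by simp, by simp⟩
  set 𝓢 := homScheme A hA B val inC outC y₀ y₁ with h𝓢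
  have hthinA : A.IsThin := hthin.of_prod y₀
  -- normalize the homomorphism on the diagonal of the first layer
  obtain ⟨ψ, hψ0⟩ : ∃ ψ : (𝓢.graph nb ty M).Adj →r (A.prod B).Adj,
      ∀ x y, ψ (⟨0, hM⟩, .inl (fun _ => x, y)) = (x, y) := by
    obtain ⟨σ, hσ⟩ := hcore ⟨fun z => φ (⟨0, hM⟩, .inl (fun _ => z.1, z.2)), fun {a b} hab =>
      φ.map_rel (Or.inl (Or.inl ⟨rfl, fun _ => hab.1, hab.2⟩))⟩
    refine ⟨(σ.symm : (A.prod B).Adj →r (A.prod B).Adj).comp φ, fun x y => ?_⟩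
    have := hσ (x, y)
    change σ.symm (φ _) = _
    rw [RelIso.symm_apply_eq, this]
    rfl
  -- The diagonal vertex `(x, y)` of layer `t + 1` is joined to the diagonal copies of all
  -- neighbours of `(x, y)` in layer `t`, so by thinness its image can only be `(x, y)`.
  have hψ : ∀ t (ht : t < M) x y, ψ (⟨t, ht⟩, .inl (fun _ => x, y)) = (x, y) := by
    intro t
    induction t with
    | zero => exact fun _ => hψ0
    | succ t ih =>
      intro ht x y
      refine (hthin (x, y) _ fun v hv => ?_).symm
      obtain ⟨v₁, v₂⟩ := v
      rw [← ih (by omega) v₁ v₂]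
      exact ψ.map_rel (Or.inr (Or.inr ⟨rfl, Or.inl ⟨_, _, _, _, rfl, rfl,
        A.symm hv.1, B.symm hv.2⟩⟩))
  have hd : ∀ t, ∃ d : D, ∀ ht : t < M, ∀ x y, (ψ (⟨t, ht⟩, .inl (x, y))).1 = x d := by
    intro t
    by_cases ht : t < M
    · obtain ⟨d, hd⟩ := hproj ⟨fun u => (ψ (⟨t, ht⟩, .inl u)).1, fun {a b} hab =>
        (ψ.map_rel (a := (⟨t, ht⟩, .inl a)) (b := (⟨t, ht⟩, .inl b)) (Or.inl (Or.inl ⟨rfl, hab⟩))).1⟩ (fun x y => congrArg Prod.fst (hψ t ht x y))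
      exact ⟨d, fun _ => hd⟩
    · exact ⟨Classical.arbitrary D, fun h => (ht h).elim⟩
  choose d hd using hd
  -- For every neighbour `v` of the intended colour, the port has a neighbour whose coordinate `d t`
  -- is `v`; the other coordinates are filled with arbitrary suitable neighbours. Thinness of `A`
  -- then determines the colour of the port.
  have hport : ∀ t (ht : t < M) p e,
      (ψ (⟨t, ht⟩, .inr (p, e))).1 = pick (A.signature (val (d t) p)) e := by
    intro t ht p e
    choose nbr hnbr using hne
    refine (hthinA _ _ fun v hv => ?_).symm
    let g : D → X := fun d => pick (A.signature (val d p)) e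
    have h1 := (ψ.map_rel (a := (⟨t, ht⟩, .inr (p, e)))
      (b := (⟨t, ht⟩, .inl (Function.update (fun c => nbr (g c)) (d t) v, y₀)))
      (Or.inl (Or.inl ⟨rfl, fun c => ?_, B.symm hy⟩))).1
    · rw [hd t ht] at h1
      simpa using h1
    · change A.Adj (g c) _
      by_cases hc : c = d t
      · subst hc; simpa using hv
      · simpa [hc] using hnbr (g c)
  refine ⟨d, fun t ht => ?_, fun t p ht v hv => ?_⟩
  -- Every neighbour `v` of the outgoing colour occurs at the left end of a linking edge, so it is
  -- also a neighbour of the incoming colour.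
  · refine (hthinA _ _ fun v hv => ?_).symm
    have h1 := (ψ.map_rel (a := (⟨t, by omega⟩, .inl (fun d => pick (A.signature {outC (ty t) d}) v, y₁)))
      (b := (⟨t + 1, ht⟩, .inl (inC (ty (t + 1)), y₀)))
      (Or.inl (Or.inr ⟨rfl, Or.inr ⟨v, rfl, rfl⟩⟩))).1
    rw [hd, hd, pick_of_mem (by rintro _ rfl; exact hv)] at h1
    exact A.symm h1
  -- Each `w ∈ S(T)` is the colour of some port, and each `v` in the later set is the colour of some
  -- vertex joined to that port. So `v ∈ S(S(T)) ⊆ T`.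
  · refine signature_signature (val (d t) p).2 fun w hw => ?_
    have h1 := (ψ.map_rel (a := (⟨t, by omega⟩, .inr (p, w)))
      (b := (⟨t + nb, ht⟩, .inl (fun d => pick (val d p : Set X) v, y₀)))
      (Or.inl (Or.inr ⟨rfl, v, rfl⟩))).1
    rw [hport, hd, pick_of_mem hw, pick_of_mem hv] at h1
    exact h1

/-- In each layer the tuples are evaluated at the chosen `d`. The edges of `carry` are respected
because the ports take colours in `S(T)`, whose elements are adjacent to all of `T`, and the later
set lies in `T`. -/
theorem hom_of_choice (hne : ∀ x, ∃ y, A.Adj x y) (hy : B.Adj y₀ y₁) (d : ℕ → D)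
    (h1 : ∀ t, t + 1 < M → inC (ty (t + 1)) (d (t + 1)) = outC (ty t) (d t))
    (h2 : ∀ t p, t + nb < M → (val (d (t + nb)) p : Set X) ⊆ val (d t) p) :
    Nonempty (((homScheme A hA B val inC outC y₀ y₁).graph nb ty M).Adj →r (A.prod B).Adj) := by
  let φ : Fin M × ((D → X) × Y ⊕ S × X) → X × Y := fun u =>
    Sum.elim (fun x => (x.1 (d u.1), x.2))
      (fun q => (pick (A.signature (val (d u.1) q.1)) q.2, y₁)) u.2
  let 𝓢 := homScheme A hA B val inC outC y₀ y₁
  have key : ∀ u v, 𝓢.Arc nb ty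
      ((u.1 : ℕ), u.2) ((v.1 : ℕ), v.2) → (A.prod B).Adj (φ u) (φ v) := by
    rintro ⟨⟨t, ht⟩, x | q⟩ ⟨⟨t', ht'⟩, y | q'⟩ h
    · obtain ⟨h, h3⟩ | ⟨h, h3⟩ := h
      · obtain rfl : t = t' := h
        exact ⟨h3.1 _, h3.2⟩
      · obtain rfl : t' = t + 1 := h
        change 𝓢.next (ty t) x (ty (t + 1)) y at h3
        obtain ⟨x, y, x', y', rfl, rfl, h4, h5⟩ | ⟨e, rfl, rfl⟩ := h3
        · exact ⟨h4, h5⟩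
        · refine ⟨?_, B.symm hy⟩
          change A.Adj (pick (A.signature {outC (ty t) (d t)}) e) (inC (ty (t + 1)) (d (t + 1)))
          rw [h1 t ht']
          obtain ⟨w, hw⟩ := hne (outC (ty t) (d t))
          exact A.symm (pick_mem (Z := A.signature {outC (ty t) (d t)})
            ⟨w, by rintro _ rfl; exact hw⟩ e _ rfl)
    · exact h.elim
    · obtain ⟨h, h3⟩ | ⟨h, h3⟩ := h
      · obtain rfl : t = t' := h
        exact ⟨h3.1 _, h3.2⟩
      · obtain rfl : t' = t + nb := h
        obtain ⟨e, rfl⟩ := h3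
        refine ⟨?_, B.symm hy⟩
        exact A.symm (pick_mem (signature_nonempty_of_mem (val (d t) q.1).2) q.2 _
          (h2 t q.1 ht' (pick_mem (val (d (t + nb)) q.1).2.1 e)))
    · exact h.elim
  exact ⟨φ, fun {u v} huv => huv.elim (key u v) fun h => (A.prod B).symm (key v u h)⟩

end LoopGraph

/-! ### Clique-width of layered graphs -/

theorem CWBuilt.insert_vertex_of_nonempty {V K : Type*} [Fintype K] {G : SimpleGraph V}
    {lab : V → K} {s : Set V} (h : s.Nonempty → CWBuilt G lab s) {v : V} (hv : v ∉ s) {new : K}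
    (hnew : ∀ w ∈ s, lab w ≠ new) {L : Set K} (hL : ∀ w ∈ s, G.Adj v w ↔ lab w ∈ L) :
    CWBuilt G lab (insert v s) := by
  rcases s.eq_empty_or_nonempty with rfl | hs
  · simpa using CWBuilt.singleton G lab v
  · exact (h hs).insert_vertex hv hnew hL

namespace LayerScheme

variable {Λ Γ S E : Type*} (𝓢 : LayerScheme Λ Γ S E) {nb M : ℕ} {ty : ℕ → Λ}

/-- The labels used to build a layered graph: a free label, a label for finished vertices, labels
for the vertices of the last two layers, and labels for the vertices waiting for a later layer. -/
abbrev Lab (Γ S : Type*) (nb : ℕ) := Option (Option ((Bool × Γ) ⊕ (Fin nb × S)))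

/-- The labels when layer `t` is built; the vertices in `S × E` wait for layers from `c` on. -/
def lab (hnb : 0 < nb) (t c : ℕ) : Fin M × (Γ ⊕ S × E) → Lab Γ S nb
  | (u, .inl x) => some (if t ≤ u + 1 then some (.inl (decide ((u : ℕ) % 2 = 0), x)) else none)
  | (u, .inr q) => some (if c ≤ u + nb then some (.inr (⟨u % nb, Nat.mod_lt _ hnb⟩, q.1)) else none)

theorem lab_ne_none (hnb : 0 < nb) (t c : ℕ) (u : Fin M × (Γ ⊕ S × E)) :
    lab hnb t c u ≠ none := by
  obtain ⟨u, x | q⟩ := u <;> simp [lab]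

/-- The labels of the neighbours of a new vertex in `Γ`. -/
def innerLabels (hnb : 0 < nb) (ty : ℕ → Λ) (t : ℕ) (x : Γ) : Set (Lab Γ S nb)
  | some (some (.inl (b, y))) => (b = decide (t % 2 = 0) ∧ 𝓢.inner x y) ∨
      (b ≠ decide (t % 2 = 0) ∧ 𝓢.next (ty (t - 1)) y (ty t) x)
  | some (some (.inr (q, p))) => q = ⟨t % nb, Nat.mod_lt _ hnb⟩ ∧ 𝓢.carry p x
  | _ => False

/-- The labels of the neighbours of a new vertex in `S × E`. -/
def portLabels (nb : ℕ) (t : ℕ) (q : S × E) : Set (Lab Γ S nb)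
  | some (some (.inl (b, y))) => b = decide (t % 2 = 0) ∧ 𝓢.port q y
  | _ => False

/-- While layer `t` is built, only layers `t - 1` and `t` are live in `Γ`, and parity separates
them. The waiting ports come from the layers `t - nb, …, t - 1`, which have distinct residues modulo
`nb`; the residue of `t` occurs only for `t - nb`. -/
theorem adj_iff_mem_innerLabels (hnb : 0 < nb) (t : Fin M) (x : Γ) (w : Fin M × (Γ ⊕ S × E))
    (hw : w.1 < t ∨ ∃ y, w = (t, .inl y)) :
    (𝓢.graph nb ty M).Adj (t, .inl x) w ↔ lab hnb t t w ∈ 𝓢.innerLabels hnb ty t x := by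
  have hdec : ∀ a b : Prop, [Decidable a] → [Decidable b] → (decide a = decide b ↔ (a ↔ b)) :=
    fun a b _ _ => decide_eq_decide
  obtain ⟨⟨u, hu⟩, y | ⟨p, e⟩⟩ := w
  · have hut : u ≤ t := by
      rcases hw with h | ⟨y, h⟩
      · exact Fin.le_def.1 h.le
      · exact (congrArg (fun w => (w.1 : ℕ)) h).le
    change ((((t : ℕ) = u ∧ 𝓢.inner x y) ∨ (u = (t : ℕ) + 1 ∧ 𝓢.next _ _ _ _)) ∨
      ((u = t ∧ 𝓢.inner y x) ∨ ((t : ℕ) = u + 1 ∧ 𝓢.next (ty u) y (ty t) x))) ↔ _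
    have hsymm : 𝓢.inner y x ↔ 𝓢.inner x y := ⟨fun h => 𝓢.symm h, fun h => 𝓢.symm h⟩
    rw [hsymm]
    simp only [lab]
    split_ifs with h
    · change _ ↔ ((decide (u % 2 = 0) = decide ((t : ℕ) % 2 = 0) ∧ 𝓢.inner x y) ∨
        (decide (u % 2 = 0) ≠ decide ((t : ℕ) % 2 = 0) ∧ 𝓢.next (ty (t - 1)) y (ty t) x))
      rw [ne_eq, hdec]
      obtain h1 | h1 : u = t ∨ u + 1 = t := by omega
      · subst h1
        simp
      · have h2 : (t : ℕ) - 1 = u := by omega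
        have h3 : ¬ (u % 2 = 0 ↔ (t : ℕ) % 2 = 0) := by omega
        have h4 : (t : ℕ) ≠ u := by omega
        have h5 : u ≠ (t : ℕ) + 1 := by omega
        simp [h2, h3, h4, h4.symm, h5, h1]
    · change _ ↔ False
      have h1 : (t : ℕ) ≠ u := by omega
      have h2 : u ≠ (t : ℕ) + 1 := by omega
      have h3 : (t : ℕ) ≠ u + 1 := by omega
      simp [h1, h1.symm, h2, h3]
  · have hut : u < t := by
      rcases hw with h | ⟨y, h⟩
      · exact Fin.lt_def.1 h
      · cases congrArg Prod.snd h
    change (False ∨ ((u = t ∧ 𝓢.port (p, e) x) ∨ ((t : ℕ) = u + nb ∧ 𝓢.carry p x))) ↔ _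
    simp only [lab]
    split_ifs with h
    · change _ ↔ ((⟨u % nb, _⟩ : Fin nb) = ⟨t % nb, _⟩ ∧ 𝓢.carry p x)
      rw [Fin.mk.injEq]
      have h1 : u ≠ t := by omega
      have h2 : (t : ℕ) = u + nb ↔ u % nb = t % nb := by
        constructor
        · intro h; rw [h]; simp
        · intro h'
          have h3 := Nat.div_add_mod u nb
          have h4 := Nat.div_add_mod t nb
          have h5 : nb * (t / nb) < nb * (u / nb + 2) := by
            rw [Nat.mul_add]; have := Nat.mod_lt u hnb; omega
          have h6 : nb * (u / nb) < nb * (t / nb) := by omega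
          have h7 := Nat.lt_of_mul_lt_mul_left h5
          have h8 := Nat.lt_of_mul_lt_mul_left h6
          have h9 : (t : ℕ) / nb = u / nb + 1 := by omega
          rw [h9, Nat.mul_add] at h4
          omega
      simp [h1, h2]
    · change _ ↔ False
      have h1 : u ≠ t := by omega
      have h2 : (t : ℕ) ≠ u + nb := by omega
      simp [h1, h2]

theorem adj_iff_mem_portLabels (hnb : 0 < nb) (t : Fin M) (q : S × E) (w : Fin M × (Γ ⊕ S × E))
    (hw : w.1 ≤ t) :
    (𝓢.graph nb ty M).Adj (t, .inr q) w ↔ lab hnb t (t + 1) w ∈ 𝓢.portLabels nb t q := by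
  obtain ⟨⟨u, hu⟩, y | q'⟩ := w
  · have hut : u ≤ t := hw
    change ((((t : ℕ) = u ∧ 𝓢.port q y) ∨ (u = (t : ℕ) + nb ∧ 𝓢.carry q.1 y)) ∨ False) ↔ _
    have h1 : u ≠ (t : ℕ) + nb := by omega
    simp only [lab]
    split_ifs with h
    · change _ ↔ (decide (u % 2 = 0) = decide ((t : ℕ) % 2 = 0) ∧ 𝓢.port q y)
      rw [decide_eq_decide]
      have h2 : (t : ℕ) = u ↔ (u % 2 = 0 ↔ (t : ℕ) % 2 = 0) := by omega
      simp [h1, h2]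
    · change _ ↔ False
      have h2 : (t : ℕ) ≠ u := by omega
      simp [h1, h2]
  · change (False ∨ False) ↔ _
    simp only [lab, or_self, false_iff]
    split_ifs with h <;> exact id

variable [Fintype Γ] [Fintype S] [Fintype E]

theorem cwBuilt_layers (hnb : 0 < nb) (t : ℕ) (ht : t ≤ M)
    (hne : {w : Fin M × (Γ ⊕ S × E) | (w.1 : ℕ) < t}.Nonempty) :
    CWBuilt (𝓢.graph nb ty M) (lab hnb t t) {w | (w.1 : ℕ) < t} := by
  classical
  induction t with
  | zero => simp at hne
  | succ t ih =>
    have ht' : t < M := ht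
    replace ih := ih (by omega)
    have h1 : ∀ C : Finset Γ, ({w : Fin M × (Γ ⊕ S × E) | (w.1 : ℕ) < t} ∪
        (fun x => (⟨t, ht'⟩, .inl x)) '' (C : Set Γ)).Nonempty →
        CWBuilt (𝓢.graph nb ty M) (lab hnb t t) ({w | (w.1 : ℕ) < t} ∪
          (fun x => (⟨t, ht'⟩, .inl x)) '' (C : Set Γ)) := by
      intro C
      induction C using Finset.induction_on with
      | empty => simpa using ih
      | insert x C hx ihC =>
        intro _
        rw [Finset.coe_insert, Set.image_insert_eq, Set.union_insert]
        refine CWBuilt.insert_vertex_of_nonempty ihC ?_ (new := none)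
          (fun w _ => lab_ne_none hnb t t w) (L := 𝓢.innerLabels hnb ty t x) ?_
        · rintro (h | ⟨y, hy, h⟩)
          · exact lt_irrefl t h
          · simp only [Prod.mk.injEq, Sum.inl.injEq, true_and] at h
            subst h; exact hx hy
        · intro w hw
          refine 𝓢.adj_iff_mem_innerLabels hnb ⟨t, ht'⟩ x w ?_
          rcases hw with h | ⟨y, -, rfl⟩
          · exact Or.inl h
          · exact Or.inr ⟨y, rfl⟩
    replace h1 : ({w : Fin M × (Γ ⊕ S × E) | (w.1 : ℕ) < t} ∪
        (fun x => (⟨t, ht'⟩, .inl x)) '' (Set.univ : Set Γ)).Nonempty →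
        CWBuilt (𝓢.graph nb ty M) (lab hnb t (t + 1)) ({w | (w.1 : ℕ) < t} ∪
          (fun x => (⟨t, ht'⟩, .inl x)) '' (Set.univ : Set Γ)) := by
      intro hs
      -- The ports of layer `t - nb` now have all their neighbours. They are retired before the
      -- ports of layer `t` enter, since these need the same residue labels.
      have := (h1 Finset.univ (by simpa using hs)).collapse
        (Finset.univ.image fun p => some (some (.inr (⟨t % nb, Nat.mod_lt _ hnb⟩, p)))) (some none)
      rw [Finset.coe_univ] at this
      refine this.congr (fun _ _ _ _ => Iff.rfl) ?_
      rintro ⟨⟨u, hu⟩, y | ⟨p, e⟩⟩ hw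
      · by_cases h : t ≤ u + 1 <;> simp [lab, h]
      · have hut : u < t := by simpa using hw
        have hmod : t % nb = u % nb ∧ t ≤ u + nb → t = u + nb := by
          rintro ⟨h, h'⟩
          obtain ⟨k, rfl⟩ := Nat.exists_eq_add_of_lt hut
          have h2 : (k + 1) % nb = 0 := by
            have h3 : (u + (k + 1)) ≡ u + 0 [MOD nb] := h
            exact Nat.ModEq.add_left_cancel' u h3
          have := Nat.le_of_dvd (by omega) (Nat.dvd_of_mod_eq_zero h2)
          omega
        by_cases h : t ≤ u + nb
        · by_cases h' : t % nb = u % nb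
          · have h2 := hmod ⟨h', h⟩
            have h3 : ¬ t + 1 ≤ u + nb := by omega
            simp [lab, h, h', h3]
          · have h3 : t + 1 ≤ u + nb := by
              rcases Nat.lt_or_ge t (u + nb) with h4 | h4
              · exact h4
              · exact absurd (show t % nb = u % nb by
                  rw [show t = u + nb by omega, Nat.add_mod_right]) h'
            simp [lab, h, h', h3]
        · have h3 : ¬ t + 1 ≤ u + nb := by omega
          simp [lab, h, h3]
    have h2 : ∀ C : Finset (S × E), ({w : Fin M × (Γ ⊕ S × E) | (w.1 : ℕ) < t} ∪
        (fun x => (⟨t, ht'⟩, .inl x)) '' (Set.univ : Set Γ) ∪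
        (fun q => (⟨t, ht'⟩, .inr q)) '' (C : Set (S × E))).Nonempty →
        CWBuilt (𝓢.graph nb ty M) (lab hnb t (t + 1)) ({w | (w.1 : ℕ) < t} ∪
          (fun x => (⟨t, ht'⟩, .inl x)) '' (Set.univ : Set Γ) ∪
          (fun q => (⟨t, ht'⟩, .inr q)) '' (C : Set (S × E))) := by
      intro C
      induction C using Finset.induction_on with
      | empty => simpa using h1
      | insert q C hq ihC =>
        intro _
        rw [Finset.coe_insert, Set.image_insert_eq, Set.union_insert]
        refine CWBuilt.insert_vertex_of_nonempty ihC ?_ (new := none)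
          (fun w _ => lab_ne_none hnb t (t + 1) w) (L := 𝓢.portLabels nb t q) ?_
        · rintro ((h | ⟨y, hy, h⟩) | ⟨y, hy, h⟩)
          · exact lt_irrefl t h
          · simp at h
          · simp only [Prod.mk.injEq, Sum.inr.injEq, true_and] at h
            subst h; exact hq hy
        · intro w hw
          refine 𝓢.adj_iff_mem_portLabels hnb ⟨t, ht'⟩ q w ?_
          rcases hw with (h | ⟨y, -, rfl⟩) | ⟨y, -, rfl⟩
          · exact le_of_lt (Fin.lt_def.2 h)
          · exact le_rfl
          · exact le_rfl
    have hset : {w : Fin M × (Γ ⊕ S × E) | (w.1 : ℕ) < t} ∪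
        (fun x => (⟨t, ht'⟩, .inl x)) '' (Set.univ : Set Γ) ∪
        (fun q => (⟨t, ht'⟩, .inr q)) '' ((Finset.univ : Finset (S × E)) : Set (S × E)) =
        {w | (w.1 : ℕ) < t + 1} := by
      ext ⟨⟨u, hu⟩, y | q⟩
      · simp; omega
      · simp; omega
    have h3 := h2 Finset.univ (by rw [hset]; exact hne)
    rw [hset] at h3
    -- Layer `t - 1` is finished in `Γ`, and its labels have the parity of `t + 1`, so they are
    -- freed for the next layer.
    refine (h3.collapse (Finset.univ.image fun x => some (some (.inl (decide ((t + 1) % 2 = 0), x))))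
      (some none)).congr (fun _ _ _ _ => Iff.rfl) ?_
    rintro ⟨⟨u, hu⟩, y | ⟨p, e⟩⟩ hw
    · have hut : u < t + 1 := hw
      by_cases h : t ≤ u + 1
      · by_cases h' : t + 1 ≤ u + 1
        · have h4 : ¬ ((t + 1) % 2 = 0 ↔ u % 2 = 0) := by omega
          simp [lab, h, h', h4]
        · have h4 : ((t + 1) % 2 = 0 ↔ u % 2 = 0) := by omega
          simp [lab, h, h', h4]
      · have h' : ¬ t + 1 ≤ u + 1 := by omega
        simp [lab, h, h']
    · by_cases h : t + 1 ≤ u + nb <;> simp [lab, h]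

/-- The bound counts the labels. The number of ports per element of `S` does not enter, so the
coefficient of `nb` is exactly the cardinality of `S`. -/
theorem cliqueWidth_graph_le (hnb : 0 < nb) :
    cliqueWidth (𝓢.graph nb ty M) ≤ nb * Fintype.card S + (2 * Fintype.card Γ + 2) := by
  have huniv : {w : Fin M × (Γ ⊕ S × E) | (w.1 : ℕ) < M} = Set.univ := by
    ext w; simp
  rcases isEmpty_or_nonempty (Fin M × (Γ ⊕ S × E)) with h | h
  -- Every expression has a vertex, so for the empty graph the infimum is over the empty set and
  -- equals 0.
  · have : cliqueWidth (𝓢.graph nb ty M) = 0 := by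
      refine Nat.sInf_eq_zero.2 (Or.inr (Set.eq_empty_of_forall_notMem ?_))
      rintro k ⟨a, ⟨e⟩⟩
      have key : ∀ {k : ℕ} (a : CWExpr k), Nonempty a.Vert := by
        intro k a
        induction a with
        | vertex i => exact ⟨Unit.unit⟩
        | union a b iha ihb => exact iha.map Sum.inl
        | relabel i j a ih => exact ih
        | join i j h a ih => exact ih
      exact (key a).elim fun v => h.elim (e v)
    omega
  · have := 𝓢.cwBuilt_layers (ty := ty) (M := M) hnb M le_rfl (by rw [huniv]; exact Set.univ_nonempty)
    rw [huniv] at this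
    refine this.cliqueWidth_le.trans (le_of_eq ?_)
    simp [Fintype.card_option, Fintype.card_sum, Fintype.card_prod]
    ring

end LayerScheme

/-! ### Evaluating a formula step by step with one bit -/

/-- The types of the layers used to evaluate a formula. A layer works on the state of one block of
`a` variables, and on a bit which tells if the current clause is satisfied so far. -/
inductive LayerType (a : ℕ) : Type
  /-- change nothing -/
  | idle
  /-- evaluate a literal -/
  | lit (p : Fin a) (s : Bool)
  /-- set the bit to `false` -/
  | reset
  /-- require that the bit is `true`, then set it to `false` -/
  | check

namespace LayerType

instance (a : ℕ) : Finite (LayerType a) := by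
  refine Finite.of_injective (β := Option (Option (Option (Fin a × Bool))))
    (fun l => match l with
      | idle => none
      | reset => some none
      | check => some (some none)
      | lit p s => some (some (some (p, s)))) ?_
  intro l l' h
  cases l <;> cases l' <;> simp_all

variable {a : ℕ} {W : Type*} (v : W → Fin a → Bool)

/-- The bit that a layer receives. -/
def inBit : LayerType a → W × Bool → Bool
  | check, _ => true
  | _, d => d.2

/-- The bit that a layer passes on. -/
def outBit : LayerType a → W × Bool → Bool
  | idle, d => d.2
  | lit p s, d => d.2 || (v d.1 p == s)
  | reset, _ => false
  | check, _ => false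

/-- A layer with block state `w` can receive the bit `i` and pass on the bit `o`. -/
def Step (l : LayerType a) (w : W) (i o : Bool) : Prop :=
  ∃ x, inBit l (w, x) = i ∧ outBit v l (w, x) = o

/-- A sequence of steps, each with a layer type and the number of its block. -/
def Exec (w : ℕ → W) : List (ℕ × LayerType a) → Bool → Bool → Prop
  | [], i, o => i = o
  | p :: l, i, o => ∃ m, Step v p.2 (w p.1) i m ∧ Exec w l m o

variable {v}

theorem exec_append {w : ℕ → W} {l l' : List (ℕ × LayerType a)} {i o : Bool} :
    Exec v w (l ++ l') i o ↔ ∃ m, Exec v w l i m ∧ Exec v w l' m o := by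
  induction l generalizing i with
  | nil => simp [Exec]
  | cons p l ih =>
    simp only [List.cons_append, Exec, ih]
    grind

theorem exec_of_chain {w : ℕ → W} {l : List (ℕ × LayerType a)} (F : ℕ → Bool) (s : ℕ)
    (h : ∀ t (ht : t < l.length), Step v l[t].2 (w l[t].1) (F (s + t)) (F (s + t + 1))) :
    Exec v w l (F s) (F (s + l.length)) := by
  induction l generalizing s with
  | nil => simp [Exec]
  | cons p l ih =>
    refine ⟨F (s + 1), h 0 (by simp), ?_⟩
    have := ih (s + 1) fun t ht => by
      have := h (t + 1) (by simpa using ht)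
      simpa [add_assoc, add_comm, add_left_comm] using this
    simpa [add_assoc, add_comm, add_left_comm] using this

theorem exists_chain_of_exec {w : ℕ → W} {l : List (ℕ × LayerType a)} {i o : Bool}
    (h : Exec v w l i o) : ∃ F : ℕ → Bool, F 0 = i ∧ F l.length = o ∧
      ∀ t (ht : t < l.length), Step v l[t].2 (w l[t].1) (F t) (F (t + 1)) := by
  induction l generalizing i with
  | nil => exact ⟨fun _ => i, rfl, h, by simp⟩
  | cons p l ih =>
    obtain ⟨m, h1, h2⟩ := h
    obtain ⟨F, h3, h4, h5⟩ := ih h2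
    refine ⟨fun t => if t = 0 then i else F (t - 1), by simp, by simpa using h4, ?_⟩
    rintro (_ | t) ht
    · simpa [h3] using h1
    · simpa using h5 t (by simpa using ht)

end LayerType

open LayerType

namespace CNFFormula

variable {a : ℕ} (ha : 0 < a)

/-- The step that evaluates a literal. -/
def litOp {n : ℕ} (l : Fin n × Bool) : ℕ × LayerType a :=
  (l.1 / a, .lit ⟨l.1 % a, Nat.mod_lt _ ha⟩ l.2)

/-- The steps that check a clause. -/
def clauseOps {n : ℕ} (c : List (Fin n × Bool)) : List (ℕ × LayerType a) :=
  (0, .reset) :: (c.map (litOp ha) ++ [(0, .check)])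

/-- The steps that check all clauses. -/
def passOps (φ : CNFFormula) : List (ℕ × LayerType a) :=
  φ.clauses.flatMap (clauseOps ha)

variable {W : Type*} {v : W → Fin a → Bool} {w : ℕ → W}

theorem exec_litOps {n : ℕ} (c : List (Fin n × Bool)) (i o : Bool) :
    Exec v w (c.map (litOp ha)) i o ↔
      o = (i || c.any fun l => v (w (l.1 / a)) ⟨l.1 % a, Nat.mod_lt _ ha⟩ == l.2) := by
  induction c generalizing i with
  | nil => simp [Exec, eq_comm]
  | cons l c ih =>
    simp only [List.map_cons, Exec, ih, litOp, Step, inBit, outBit, List.any_cons]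
    constructor
    · rintro ⟨m, ⟨x, rfl, rfl⟩, rfl⟩
      simp [Bool.or_assoc]
    · rintro rfl
      exact ⟨_, ⟨i, rfl, rfl⟩, by simp [Bool.or_assoc]⟩

/-- The literals accumulate a disjunction after the initial reset, and the final step accepts only
`true`. The bit is `false` afterwards, so clauses, and whole passes, can be concatenated. -/
theorem exec_clauseOps {n : ℕ} (c : List (Fin n × Bool)) (i o : Bool) :
    Exec v w (clauseOps ha c) i o ↔
      (∃ l ∈ c, v (w (l.1 / a)) ⟨l.1 % a, Nat.mod_lt _ ha⟩ = l.2) ∧ o = false := by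
  simp only [clauseOps, Exec, exec_append, exec_litOps, Step, inBit, outBit]
  constructor
  · rintro ⟨_, ⟨x, rfl, rfl⟩, m, hm, m', ⟨y, rfl, rfl⟩, rfl⟩
    refine ⟨?_, rfl⟩
    simpa using hm.symm
  · rintro ⟨⟨l, hl, h⟩, rfl⟩
    refine ⟨false, ⟨i, rfl, rfl⟩, true, ?_, false, ⟨false, rfl, rfl⟩, rfl⟩
    rw [Bool.false_or]
    exact (List.any_eq_true.2 ⟨l, hl, by simpa using h⟩).symm

theorem forall_of_exec_passOps {n : ℕ} {cs : List (List (Fin n × Bool))} {i o : Bool}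
    (h : Exec v w (cs.flatMap (clauseOps ha)) i o) :
    ∀ c ∈ cs, ∃ l ∈ c, v (w (l.1 / a)) ⟨l.1 % a, Nat.mod_lt _ ha⟩ = l.2 := by
  induction cs generalizing i with
  | nil => simp
  | cons c cs ih =>
    rw [List.flatMap_cons, exec_append] at h
    obtain ⟨m, h1, h2⟩ := h
    rw [List.forall_mem_cons]
    exact ⟨((exec_clauseOps ha c i m).1 h1).1, ih h2⟩

theorem exec_passOps {n : ℕ} {cs : List (List (Fin n × Bool))}
    (h : ∀ c ∈ cs, ∃ l ∈ c, v (w (l.1 / a)) ⟨l.1 % a, Nat.mod_lt _ ha⟩ = l.2) :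
    Exec v w (cs.flatMap (clauseOps ha)) false false := by
  induction cs with
  | nil => rfl
  | cons c cs ih =>
    rw [List.flatMap_cons, exec_append]
    rw [List.forall_mem_cons] at h
    exact ⟨false, (exec_clauseOps ha c _ _).2 ⟨h.1, rfl⟩, ih h.2⟩

end CNFFormula

/-! ### Sweeps over the blocks and repetition of the formula -/

/-- The layer types of a sequence of sweeps over all blocks: sweep `t` performs the step `op t`. -/
def sweepType {a : ℕ} (nb : ℕ) (op : ℕ → ℕ × LayerType a) (t : ℕ) : LayerType a :=
  if t % nb = (op (t / nb)).1 then (op (t / nb)).2 else .idle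

/-- The element `t` of the periodic repetition of a list. -/
def cyclicGet {α : Type*} (l : List α) (z : α) (t : ℕ) : α := l.getD (t % l.length) z

theorem succ_div_mod {nb : ℕ} (hnb : 0 < nb) (t : ℕ) :
    ((t + 1) / nb = t / nb ∧ (t + 1) % nb = t % nb + 1 ∧ t % nb + 1 < nb) ∨
      ((t + 1) / nb = t / nb + 1 ∧ (t + 1) % nb = 0 ∧ t % nb + 1 = nb) := by
  have h1 := Nat.mod_lt t hnb
  have h2 := Nat.div_add_mod t nb
  rcases Nat.lt_or_ge (t % nb + 1) nb with h | h
  · have h4 : t + 1 = (t % nb + 1) + nb * (t / nb) := by omega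
    left
    refine ⟨?_, ?_, h⟩
    · rw [h4, Nat.add_mul_div_left _ _ hnb, Nat.div_eq_of_lt h, zero_add]
    · rw [h4, Nat.add_mul_mod_self_left, Nat.mod_eq_of_lt h]
  · have h4 : t + 1 = nb * (t / nb + 1) := by rw [Nat.mul_add]; omega
    right
    refine ⟨?_, ?_, by omega⟩
    · rw [h4, Nat.mul_div_cancel_left _ hnb]
    · rw [h4, Nat.mul_mod_right]

/-- In a decreasing sequence of finite sets, each period that is not constant loses an element, and
there are fewer elements than periods. -/
theorem exists_constant_period {P : Type*} (F : ℕ → Finset P) {R L C : ℕ}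
    (hF : ∀ t, t + 1 < R * L → F (t + 1) ⊆ F t) (hC : (F 0).card ≤ C) (hR : C < R) :
    ∃ r < R, ∀ t < L, F (r * L + t) = F (r * L) := by
  by_contra! hno
  have hmono : ∀ t k, t + k < R * L → F (t + k) ⊆ F t := by
    intro t k
    induction k with
    | zero => intro _; exact subset_rfl
    | succ k ih => intro h; exact (hF (t + k) h).trans (ih (by omega))
  have hle : ∀ r < R, r * L + L ≤ R * L := by
    intro r hr
    have := Nat.mul_le_mul_right L (show r + 1 ≤ R from hr)
    rwa [Nat.add_mul, one_mul] at this
  have hlt : ∀ r < R, ∃ t < L, (F (r * L + t)).card < (F (r * L)).card := by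
    intro r hr
    obtain ⟨t, ht, hne⟩ := hno r hr
    have := hle r hr
    exact ⟨t, ht, Finset.card_lt_card ((hmono (r * L) t (by omega)).ssubset_of_ne hne)⟩
  have key : ∀ r < R, (F (r * L)).card + r ≤ C := by
    intro r
    induction r with
    | zero => simpa using fun _ => hC
    | succ r ih =>
      intro hr
      obtain ⟨t, ht, h1⟩ := hlt r (by omega)
      have h2 := ih (by omega)
      have h3 := hle (r + 1) hr
      have h4 := hmono (r * L + t) (L - t) (by rw [Nat.add_mul, one_mul] at h3; omega)
      rw [show r * L + t + (L - t) = (r + 1) * L by rw [Nat.add_mul, one_mul]; omega] at h4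
      have := Finset.card_le_card h4
      omega
  obtain ⟨t, -, h1⟩ := hlt (R - 1) (by omega)
  have := key (R - 1) (by omega)
  omega

section

variable {a : ℕ} {W : Type*} {v : W → Fin a → Bool} {nb : ℕ} {op : ℕ → ℕ × LayerType a}

/-- Within a sweep the bit keeps its old value up to the block where the step acts, and has the new
value after it; all other layers are idle and copy it. -/
theorem exists_choice_of_step (hop : ∀ t, (op t).1 < nb) (w : ℕ → W) (G : ℕ → Bool)
    (hG : ∀ t, Step v (op t).2 (w (op t).1) (G t) (G (t + 1))) :
    ∃ d : ℕ → W × Bool, (∀ t, inBit (sweepType nb op (t + 1)) (d (t + 1)) =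
        outBit v (sweepType nb op t) (d t)) ∧ ∀ t, (d t).1 = w (t % nb) := by
  have hnb : 0 < nb := (Nat.zero_le _).trans_lt (hop 0)
  let f : ℕ → Bool := fun t => if t % nb ≤ (op (t / nb)).1 then G (t / nb) else G (t / nb + 1)
  have hf : ∀ t, Step v (sweepType nb op t) (w (t % nb)) (f t) (f (t + 1)) := by
    intro t
    have h1 := Nat.mod_lt t hnb
    have h3 := succ_div_mod hnb t
    have h5 := hop (t / nb)
    unfold sweepType
    split_ifs with h
    · have e1 : f t = G (t / nb) := if_pos h.le
      have e2 : f (t + 1) = G (t / nb + 1) := by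
        rcases h3 with ⟨h6, h7, h8⟩ | ⟨h6, h7, h8⟩
        · simp only [f, h6, h7]
          exact if_neg (by omega)
        · simp only [f, h6, h7]
          exact if_pos (Nat.zero_le _)
      rw [e1, e2, h]
      exact hG _
    · refine ⟨f t, rfl, ?_⟩
      change f t = f (t + 1)
      rcases h3 with ⟨h6, h7, h8⟩ | ⟨h6, h7, h8⟩
      · simp only [f, h6, h7]
        by_cases h9 : t % nb ≤ (op (t / nb)).1
        · rw [if_pos h9, if_pos (by omega)]
        · rw [if_neg h9, if_neg (by omega)]
      · simp only [f, h6, h7]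
        rw [if_neg (by omega), if_pos (Nat.zero_le _)]
  choose x hx1 hx2 using hf
  exact ⟨fun t => (w (t % nb), x t), fun t => (hx1 (t + 1)).trans (hx2 t).symm, fun t => rfl⟩

theorem exists_step_of_choice (hop : ∀ t, (op t).1 < nb) {N : ℕ} (d : ℕ → W × Bool)
    (hd : ∀ t, t + 1 < N * nb → inBit (sweepType nb op (t + 1)) (d (t + 1)) =
        outBit v (sweepType nb op t) (d t)) :
    ∃ G : ℕ → Bool, ∀ t < N, Step v (op t).2 (d (t * nb + (op t).1)).1 (G t) (G (t + 1)) := by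
  have hnb : 0 < nb := (Nat.zero_le _).trans_lt (hop 0)
  -- `f t` is the bit between layers `t - 1` and `t`. The first layer has no predecessor, so there
  -- it is the bit that this layer itself expects.
  let f : ℕ → Bool := fun t => t.casesOn (inBit (sweepType nb op 0) (d 0))
    fun s => outBit v (sweepType nb op s) (d s)
  have hf : ∀ t < N * nb, Step v (sweepType nb op t) (d t).1 (f t) (f (t + 1)) := by
    rintro (_ | t) ht
    · exact ⟨_, rfl, rfl⟩
    · exact ⟨_, hd t ht, rfl⟩
  refine ⟨fun t => f (t * nb), fun t ht => ?_⟩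
  have hlt : ∀ j < nb, t * nb + j < N * nb := by
    intro j hj
    have := Nat.mul_le_mul_right nb (show t + 1 ≤ N from ht)
    rw [Nat.add_mul, one_mul] at this
    omega
  have hty : ∀ j < nb, sweepType nb op (t * nb + j) = if j = (op t).1 then (op t).2 else .idle := by
    intro j hj
    have h1 : (t * nb + j) / nb = t := by
      rw [mul_comm, Nat.mul_add_div hnb, Nat.div_eq_of_lt hj, add_zero]
    have h2 : (t * nb + j) % nb = j := by
      rw [mul_comm, Nat.mul_add_mod, Nat.mod_eq_of_lt hj]
    simp only [sweepType, h1, h2]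
  have hidle : ∀ j < nb, j ≠ (op t).1 → f (t * nb + j + 1) = f (t * nb + j) := by
    intro j hj hne
    have := hf _ (hlt j hj)
    rw [hty j hj, if_neg hne] at this
    obtain ⟨x, h1, h2⟩ := this
    exact h2.symm.trans h1
  have h1 : ∀ j ≤ (op t).1, f (t * nb + j) = f (t * nb) := by
    intro j
    induction j with
    | zero => intro _; rfl
    | succ j ih =>
      intro h
      have := hop t
      rw [← ih (by omega), ← hidle j (by omega) (by omega)]
      rfl
  have h2 : ∀ k, (op t).1 + 1 + k ≤ nb →
      f (t * nb + ((op t).1 + 1 + k)) = f (t * nb + (op t).1 + 1) := by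
    intro k
    induction k with
    | zero => intro _; rfl
    | succ k ih =>
      intro h
      rw [← ih (by omega)]
      exact hidle ((op t).1 + 1 + k) (by omega) (by omega)
  have h3 := hf _ (hlt _ (hop t))
  have h4 := hop t
  rw [hty _ h4, if_pos rfl, h1 _ le_rfl, ← h2 (nb - (op t).1 - 1) (by omega),
    show (op t).1 + 1 + (nb - (op t).1 - 1) = nb by omega] at h3
  simpa [Nat.add_mul] using h3

end

/-! ### Choices of states and satisfying assignments -/

namespace CNFFormula

variable {a : ℕ} (ha : 0 < a) (φ : CNFFormula) {W S X : Type*} [Fintype S] [Fintype X]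
  {v : W → Fin a → Bool} {val : W → S → Set X}

/-- The layer types for the repeated evaluation of a formula. -/
def layerTypes (φ : CNFFormula) : ℕ → LayerType a :=
  sweepType (φ.n / a + 1) (cyclicGet (φ.passOps ha) (0, .idle))

theorem cyclicGet_passOps_fst_lt (t : ℕ) :
    (cyclicGet (φ.passOps ha) (0, .idle) t).1 < φ.n / a + 1 := by
  have key : ∀ p ∈ φ.passOps ha, p.1 < φ.n / a + 1 := by
    intro p hp
    simp only [passOps, List.mem_flatMap, clauseOps, List.mem_cons, List.mem_append, List.mem_map,
      List.not_mem_nil, or_false] at hp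
    obtain ⟨c, -, rfl | ⟨l, -, rfl⟩ | rfl⟩ := hp
    · exact Nat.succ_pos _
    · exact Nat.lt_succ_of_le (Nat.div_le_div_right l.1.2.le)
    · exact Nat.succ_pos _
  unfold cyclicGet
  rcases Nat.lt_or_ge (t % (φ.passOps ha).length) (φ.passOps ha).length with h | h
  · rw [List.getD_eq_getElem _ _ h]
    exact key _ (List.getElem_mem h)
  · rw [List.getD_eq_default _ _ h]
    exact Nat.succ_pos _

theorem exists_choice_of_satisfiable (hv : Function.Surjective v) (hφ : φ.Satisfiable)
    (hne : φ.clauses ≠ []) :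
    ∃ d : ℕ → W × Bool, (∀ t, inBit (φ.layerTypes ha (t + 1)) (d (t + 1)) =
        outBit v (φ.layerTypes ha t) (d t)) ∧ ∀ t, (d (t + (φ.n / a + 1))).1 = (d t).1 := by
  obtain ⟨α, hα⟩ := hφ
  -- `w β` encodes the assignment on block `β`; positions beyond the last variable get `false`.
  choose w hw using fun β : ℕ => hv fun p => if h : β * a + p < φ.n then α ⟨β * a + p, h⟩ else false
  have hval : ∀ x : Fin φ.n, v (w (x / a)) ⟨x % a, Nat.mod_lt _ ha⟩ = α x := by
    intro x
    rw [hw]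
    have : (x : ℕ) / a * a + x % a = x := Nat.div_add_mod' _ _
    simp [this]
  have h1 : Exec v w (φ.passOps ha) false false := by
    refine exec_passOps ha fun c hc => ?_
    obtain ⟨l, hl, h⟩ := hα c hc
    exact ⟨l, hl, (hval l.1).trans h⟩
  obtain ⟨F, hF0, hF1, hF⟩ := exists_chain_of_exec h1
  have hpos : 0 < (φ.passOps ha).length := by
    obtain ⟨c, cs, h⟩ := List.exists_cons_of_ne_nil hne
    rw [passOps, h]
    simp [clauseOps]
  obtain ⟨d, hd, hd'⟩ := exists_choice_of_step (φ.cyclicGet_passOps_fst_lt ha) w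
    (fun t => F (t % (φ.passOps ha).length)) fun t => by
      have h2 := Nat.mod_lt t hpos
      have h3 := hF _ h2
      rw [cyclicGet, List.getD_eq_getElem _ _ h2]
      have h4 : F ((t + 1) % (φ.passOps ha).length) = F (t % (φ.passOps ha).length + 1) := by
        rcases succ_div_mod hpos t with ⟨-, h5, -⟩ | ⟨-, h5, h6⟩
        · rw [h5]
        · rw [h5, h6, hF0, hF1]
      rwa [h4]
  exact ⟨d, hd, fun t => by rw [hd', hd', Nat.add_mod_right]⟩

/-- The block states may change between sweeps, but only by shrinking their sets. During a pass in
which they are constant, the bits form an execution for a single assignment. -/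
theorem satisfiable_of_choice (hval : ∀ w w', (∀ p, val w p = val w' p) → w = w') {R : ℕ}
    (hR : (φ.n / a + 1) * (Fintype.card S * Fintype.card X) < R) (d : ℕ → W × Bool)
    (h1 : ∀ t, t + 1 < R * (φ.passOps ha).length * (φ.n / a + 1) →
      inBit (φ.layerTypes ha (t + 1)) (d (t + 1)) = outBit v (φ.layerTypes ha t) (d t))
    (h2 : ∀ t p, t + (φ.n / a + 1) < R * (φ.passOps ha).length * (φ.n / a + 1) →
      val (d (t + (φ.n / a + 1))).1 p ⊆ val (d t).1 p) : φ.Satisfiable := by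
  classical
  set nb := φ.n / a + 1 with hnb
  set L := (φ.passOps ha).length with hL
  obtain ⟨G, hG⟩ := exists_step_of_choice (φ.cyclicGet_passOps_fst_lt ha) d h1
  -- All block states in sweep `t` are collected in one finite set, so that a single decreasing
  -- sequence controls them.
  let F : ℕ → Finset (Fin nb × S × X) := fun t =>
    Finset.univ.filter fun z => z.2.2 ∈ val (d (t * nb + z.1)).1 z.2.1
  obtain ⟨r, hr, hF⟩ := exists_constant_period F (R := R) (L := L)
    (C := nb * (Fintype.card S * Fintype.card X)) (fun t ht => by
      intro z hz
      simp only [F, Finset.mem_filter, Finset.mem_univ, true_and] at hz ⊢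
      have e : (t + 1) * nb + z.1 = t * nb + z.1 + nb := by ring
      rw [e] at hz
      refine h2 _ _ ?_ hz
      have h3 := Nat.mul_le_mul_right nb (show t + 1 + 1 ≤ R * L from ht)
      rw [Nat.add_mul, Nat.add_mul, one_mul] at h3
      have := z.1.2
      omega) (by
      refine (Finset.card_le_univ _).trans ?_
      simp) hR
  have hconst : ∀ t < L, ∀ β < nb, (d ((r * L + t) * nb + β)).1 = (d (r * L * nb + β)).1 := by
    intro t ht β hβ
    refine hval _ _ fun p => ?_
    ext x
    have := Finset.ext_iff.1 (hF t ht) (⟨β, hβ⟩, p, x)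
    simpa [F] using this
  have hexec := exec_of_chain (v := v) (w := fun β => (d (r * L * nb + β)).1) (l := φ.passOps ha) G
    (r * L) fun t ht => by
      have h3 : r * L + t < R * L := by
        have := Nat.mul_le_mul_right L (show r + 1 ≤ R from hr)
        rw [Nat.add_mul, one_mul] at this
        omega
      have h4 := hG _ h3
      have h5 : cyclicGet (φ.passOps ha) (0, .idle) (r * L + t) = (φ.passOps ha)[t] := by
        rw [cyclicGet, ← hL, mul_comm, Nat.mul_add_mod, Nat.mod_eq_of_lt ht,
          List.getD_eq_getElem _ _ ht]
      have h6 := φ.cyclicGet_passOps_fst_lt ha (r * L + t)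
      rw [h5] at h4 h6
      rwa [hconst t ht _ h6] at h4
  exact ⟨fun x => v (d (r * L * nb + x / a)).1 ⟨x % a, Nat.mod_lt _ ha⟩,
    forall_of_exec_passOps ha hexec⟩

end CNFFormula

/-! ### Polynomial-time computability of the construction -/

open Data

namespace PolyTime

variable {f g h : Data → Data}

open Classical in
/-- The property `P` is decidable in polynomial time. -/
def _root_.PolyDec (P : Data → Prop) : Prop := PolyTime fun x => encodeBool (decide (P x))

theorem _root_.PolyDec.comp {P : Data → Prop} (hP : PolyDec P) (hf : PolyTime f) :
    PolyDec fun x => P (f x) :=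
  PolyTime.comp hP hf

theorem _root_.PolyDec.and {P Q : Data → Prop} (hP : PolyDec P) (hQ : PolyDec Q) :
    PolyDec fun x => P x ∧ Q x := by
  classical
  refine (ite_decide hP hQ .nil).congr fun x => ?_
  by_cases h1 : P x
  · simp [h1]
  · simp [h1]; rfl

theorem _root_.PolyDec.or {P Q : Data → Prop} (hP : PolyDec P) (hQ : PolyDec Q) :
    PolyDec fun x => P x ∨ Q x := by
  classical
  refine (ite_decide hP (const (encodeBool true)) hQ).congr fun x => ?_
  by_cases h1 : P x <;> simp [h1]

theorem polyDec_length_eq (hf : PolyTime f) (hg : PolyTime g) :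
    PolyDec fun x => (f x).toList.length = (g x).toList.length :=
  (length_eq hf hg).congr fun _ => congrArg encodeBool (by congr)

theorem exists_table {α : Type*} [Finite α] {code : α → Data} (hc : Function.Injective code)
    (F : α → Data) : ∃ G, PolyTime G ∧ ∀ x, G (code x) = F x := by
  obtain ⟨G, hG, h⟩ := exists_eqOn (Function.extend code F fun _ => .nil)
    (Set.finite_range code).toFinset.toList
  exact ⟨G, hG, fun x => by rw [h _ (by simp), hc.extend_apply]⟩

theorem exists_dec_table {α : Type*} [Finite α] {code : α → Data} (hc : Function.Injective code)
    (P : α → Prop) : ∃ Q, PolyDec Q ∧ ∀ x, Q (code x) ↔ P x := by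
  classical
  obtain ⟨G, hG, h⟩ := exists_table hc fun x => encodeBool (decide (P x))
  refine ⟨fun x => G x ≠ .nil, ?_, fun x => by simp [h, encodeBool_eq_nil]⟩
  refine (PolyTime.ite hG (const (encodeBool true)) .nil).congr fun x => ?_
  by_cases h1 : G x = .nil
  · simp [h1]; rfl
  · simp [h1]

end PolyTime

theorem encodeNat_injective : Function.Injective encodeNat := by
  intro m n h
  simpa using congrArg Data.size h

theorem encodeBool_injective : Function.Injective encodeBool := by
  intro m n h
  cases m <;> cases n <;> simp_all [encodeBool]

theorem exists_code (α : Type*) [Finite α] : ∃ code : α → Data, Function.Injective code :=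
  ⟨fun x => encodeNat (Finite.equivFin α x),
    encodeNat_injective.comp (Fin.val_injective.comp (Finite.equivFin α).injective)⟩

open Classical in
theorem encodeGraph_comap_get {V : Type*} (G : SimpleGraph V) (vs : List V) :
    encodeGraph (G.comap vs.get) = encodeList (vs.map fun u =>
      encodeList (vs.map fun v => encodeBool (decide (G.Adj u v)))) := by
  have key : ∀ f : V → Data, List.ofFn (fun i => f (vs.get i)) = vs.map f := by
    intro f
    conv_rhs => rw [← List.ofFn_get vs, List.map_ofFn]
    rfl
  rw [← key]
  unfold encodeGraph
  congr 2
  funext i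
  rw [← key]
  rfl

theorem List.flatMap_map_range {α β : Type*} (l : List α) (k : ℕ) (g : α → ℕ → β) (z : α) :
    l.flatMap (fun a => (List.range k).map (g a)) =
      (List.range (l.length * k)).map fun t => g (l.getD (t / k) z) (t % k) := by
  rcases Nat.eq_zero_or_pos k with rfl | hk
  · simp
  induction l with
  | nil => simp
  | cons a l ih =>
    rw [List.flatMap_cons, ih, List.length_cons, Nat.add_mul, one_mul, Nat.add_comm,
      List.range_add, List.map_append, List.map_map]
    congr 1
    · refine List.map_congr_left fun t ht => ?_
      have ht := List.mem_range.1 ht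
      simp [Nat.div_eq_of_lt ht, Nat.mod_eq_of_lt ht]
    · refine List.map_congr_left fun t ht => ?_
      simp [Nat.add_div_left t hk]

theorem List.flatMap_const_eq_map_cyclicGet {α β : Type*} (l : List α) (l' : List β) (z : β) :
    l.flatMap (fun _ => l') = (List.range (l.length * l'.length)).map (cyclicGet l' z) := by
  rcases l with _ | ⟨a, l⟩
  · simp
  have : l' = (List.range l'.length).map fun t => l'.getD t z := by
    refine List.ext_getElem (by simp) fun i h1 h2 => ?_
    rw [List.getElem_map, List.getElem_range, List.getD_eq_getElem _ _ h1]
  conv_lhs => rw [this]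
  rw [List.flatMap_map_range _ _ (fun _ t => l'.getD t z) a]
  rfl

namespace CNFFormula

variable {a : ℕ} (ha : 0 < a)

/-- The list of the types of all layers is computable in polynomial time. -/
theorem exists_polyTime_layerTypes (code : LayerType a → Data) (K : ℕ) :
    ∃ f, PolyTime f ∧ ∀ φ : CNFFormula, f φ.encode = encodeList ((List.range
      (((φ.n / a + 1) * K + 1) * (φ.passOps ha).length * (φ.n / a + 1))).map
        fun t => code (φ.layerTypes ha t)) := by
  classical
  -- the number of blocks
  let nbD : Data → Data := fun x => pair .nil (encodeNat ((toList x.left).length / a))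
  have hnbD : PolyTime nbD := .pair .nil (PolyTime.divMod ha PolyTime.id.left).left
  -- literals
  obtain ⟨T, hT, hT'⟩ := PolyTime.exists_table
    (α := Fin a × Bool) (code := fun z => pair (encodeNat z.1) (encodeBool z.2)) (by
      rintro ⟨⟨p, hp⟩, s⟩ ⟨⟨p', hp'⟩, s'⟩ h
      simp only [pair, BinaryTree.node.injEq, true_and] at h
      have h1 := encodeNat_injective h.1
      have h2 := encodeBool_injective h.2
      subst h1; subst h2; rfl) fun z => code (.lit z.1 z.2)
  let litD : Data → Data := fun l => pair (encodeNat ((toList l.left).length / a))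
    (T (pair (encodeNat ((toList l.left).length % a)) l.right))
  have hlitD : PolyTime litD :=
    .pair (PolyTime.divMod ha PolyTime.id.left).left
      (hT.comp (.pair (PolyTime.divMod ha PolyTime.id.left).right PolyTime.id.right))
  let opCode : ℕ × LayerType a → Data := fun p => pair (encodeNat p.1) (code p.2)
  have hlit : ∀ {n : ℕ} (l : Fin n × Bool), litD (pair (encodeNat l.1) (encodeBool l.2)) =
      opCode (litOp ha l) := by
    intro n l
    simp only [litD, opCode, litOp, BinaryTree.left, BinaryTree.right, toList_encodeNat,
      List.length_replicate]
    rw [← hT' (⟨l.1 % a, Nat.mod_lt _ ha⟩, l.2)]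
  -- clauses
  let clauseD : Data → Data := fun c => pair (opCode (0, .reset))
    (encodeList ((encodeList (c.toList.map litD)).toList ++
      (pair (opCode (0, .check)) .nil).toList))
  have hclauseD : PolyTime clauseD := .pair (.const _)
    (.append (.map (F := fun _ l => litD l) .id (hlitD.comp PolyTime.id.right)) (.const _))
  let encC : ∀ {n : ℕ}, List (Fin n × Bool) → Data := fun c =>
    encodeList (c.map fun l => pair (encodeNat l.1) (encodeBool l.2))
  have hclause : ∀ {n : ℕ} (c : List (Fin n × Bool)),
      (clauseD (encC c)).toList = (clauseOps ha c).map opCode := by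
    intro n c
    simp [clauseD, encC, clauseOps, hlit, Function.comp_def]
  let passD : Data → Data := fun x =>
    encodeList ((toList x.right).flatMap fun c => (clauseD c).toList)
  have hpassD : PolyTime passD :=
    .flatMap (F := fun _ c => clauseD c) PolyTime.id.right (hclauseD.comp PolyTime.id.right)
  have hpass : ∀ φ : CNFFormula, (passD φ.encode).toList = (φ.passOps ha).map opCode := by
    intro φ
    have : φ.encode.right = encodeList (φ.clauses.map encC) := rfl
    simp only [passD, this, toList_encodeList, passOps, List.flatMap_map, List.map_flatMap, hclause]
  -- the repetition of the pass
  let repD : Data → Data := fun x =>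
    pair .nil (encodeList ((nbD x).toList.flatMap fun _ => (encodeNat K).toList))
  have hrepD : PolyTime repD :=
    .pair .nil (.flatMap (F := fun _ _ => encodeNat K) hnbD (.const _))
  let allD : Data → Data := fun x =>
    encodeList ((repD x).toList.flatMap fun _ => (passD x).toList)
  have hallD : PolyTime allD :=
    .flatMap (F := fun x _ => passD x) hrepD (hpassD.comp PolyTime.id.left)
  -- the sweeps
  let blocksD : Data → Data := fun x =>
    encodeList (encodeList (Data.suffixes (nbD x).toList)).toList.reverse
  have hblocksD : PolyTime blocksD := .reverse (.suffixes hnbD)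
  -- Only nonempty suffixes are listed, so block `j` appears as the unary number `j + 1`; therefore
  -- the block number of the step is increased by one before the comparison.
  let sweepD : Data → Data → Data := fun x p => encodeList ((blocksD x).toList.map fun o =>
    if o.toList.length = (pair .nil p.left).toList.length then p.right else code .idle)
  have hsweepD : PolyTime fun z => sweepD z.left z.right :=
    .map (F := fun z o => if o.toList.length = (pair .nil z.right.left).toList.length then
      z.right.right else code .idle) (hblocksD.comp PolyTime.id.left)
      (PolyTime.ite_decide (PolyTime.length_eq PolyTime.id.right
        (.pair .nil PolyTime.id.left.right.left)) PolyTime.id.left.right.right (.const _))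
  refine ⟨fun x => encodeList ((allD x).toList.flatMap fun p => (sweepD x p).toList),
    .flatMap hallD hsweepD, fun φ => ?_⟩
  have hleft : φ.encode.left = encodeNat φ.n := rfl
  have hnb : nbD φ.encode = encodeNat (φ.n / a + 1) := by
    simp only [nbD, hleft, toList_encodeNat, List.length_replicate, encodeNat_succ]
  have hblocks : (blocksD φ.encode).toList =
      (List.range (φ.n / a + 1)).map fun j => encodeNat (j + 1) := by
    simp only [blocksD, hnb, toList_encodeList, Data.suffixes, toList_encodeNat,
      List.length_replicate]
    refine List.ext_getElem (by simp) fun i h1 h2 => ?_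
    simp only [List.length_map, List.length_range] at h2
    simp only [List.getElem_reverse, List.getElem_map, List.getElem_range, List.drop_replicate,
      List.length_map, List.length_range, encodeNat]
    congr 2
    omega
  have hsweep : ∀ p : ℕ × LayerType a, (sweepD φ.encode (opCode p)).toList =
      (List.range (φ.n / a + 1)).map fun j => code (if j = p.1 then p.2 else .idle) := by
    intro p
    simp only [sweepD, hblocks, toList_encodeList, List.map_map]
    refine List.map_congr_left fun j _ => ?_
    simp only [Function.comp, opCode, BinaryTree.left, BinaryTree.right, toList_pair,
      List.length_cons, toList_encodeNat, List.length_replicate, Nat.add_right_cancel_iff]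
    split_ifs <;> rfl
  have hrep : (repD φ.encode).toList.length = (φ.n / a + 1) * K + 1 := by
    simp [repD, hnb, List.length_flatMap]
    ring
  have hall : (allD φ.encode).toList = ((List.range (((φ.n / a + 1) * K + 1) *
      (φ.passOps ha).length)).map (cyclicGet (φ.passOps ha) (0, .idle))).map opCode := by
    rw [← hrep, ← List.flatMap_const_eq_map_cyclicGet]
    simp only [allD, toList_encodeList, hpass, List.map_flatMap]
  beta_reduce
  rw [hall, List.flatMap_map]
  simp only [hsweep]
  rw [List.flatMap_map_range _ _ (fun p j => code (if j = p.1 then p.2 else .idle)) (0, .idle)]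
  simp only [List.length_map, List.length_range]
  congr 1
  refine List.map_congr_left fun t ht => ?_
  have h1 : t / (φ.n / a + 1) < ((φ.n / a + 1) * K + 1) * (φ.passOps ha).length :=
    Nat.div_lt_of_lt_mul (by rw [mul_comm]; exact List.mem_range.1 ht)
  rw [List.getD_eq_getElem _ _ (by simpa using h1), List.getElem_map, List.getElem_range]
  rfl

end CNFFormula

namespace LayerScheme

/-- A layered graph is computable in polynomial time from the number `nb` and the list of the types
of its layers. -/
theorem exists_polyTime_graph {Λ Γ S E : Type*} [Finite Λ] [Finite Γ] [Finite S] [Finite E]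
    (𝓢 : LayerScheme Λ Γ S E) {code : Λ → Data} (hc : Function.Injective code) :
    ∃ f, PolyTime f ∧ ∀ (nb : ℕ) (ty : ℕ → Λ) (M : ℕ), ∃ (N : ℕ) (G : SimpleGraph (Fin N)),
      f (pair (encodeNat nb) (encodeList ((List.range M).map fun t => code (ty t)))) =
        encodeGraph G ∧ Nonempty (G ≃g 𝓢.graph nb ty M) := by
  classical
  have := Fintype.ofFinite (Γ ⊕ S × E)
  obtain ⟨codeP, hcP⟩ := exists_code (Γ ⊕ S × E)
  let key : (Λ × (Γ ⊕ S × E)) × (Λ × (Γ ⊕ S × E)) → Data := fun z =>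
    pair (pair (code z.1.1) (codeP z.1.2)) (pair (code z.2.1) (codeP z.2.2))
  have hkey : Function.Injective key := by
    rintro ⟨⟨l, p⟩, l', p'⟩ ⟨⟨m, q⟩, m', q'⟩ h
    simpa [key, hc.eq_iff, hcP.eq_iff, and_assoc] using h
  obtain ⟨T₀, hT₀, hT₀'⟩ := PolyTime.exists_dec_table hkey fun z => match z.1.2, z.2.2 with
    | .inl x, .inl y => 𝓢.inner x y
    | .inr q, .inl y => 𝓢.port q y
    | _, .inr _ => False
  obtain ⟨T₁, hT₁, hT₁'⟩ := PolyTime.exists_dec_table hkey fun z => match z.1.2, z.2.2 with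
    | .inl x, .inl y => 𝓢.next z.1.1 x z.2.1 y
    | _, _ => False
  obtain ⟨T₂, hT₂, hT₂'⟩ := PolyTime.exists_dec_table hkey fun z => match z.1.2, z.2.2 with
    | .inr q, .inl y => 𝓢.carry q.1 y
    | _, _ => False
  -- a vertex is represented by the list of the types of the remaining layers and its code
  let keyD : Data → Data → Data := fun u v =>
    pair (pair u.left.left u.right) (pair v.left.left v.right)
  -- The suffix at layer `t` has length `M - t`, so equality of layers and distances 1 and `nb`
  -- become equalities of lengths. The types needed for the table lookup are the heads of the
  -- suffixes.
  let arcD : Data → Data → Data → Prop := fun nb u v =>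
    ((toList u.left).length = (toList v.left).length ∧ T₀ (keyD u v)) ∨
    ((toList u.left).length = (pair .nil v.left).toList.length ∧ T₁ (keyD u v)) ∨
    ((toList u.left).length = (encodeList (nb.toList ++ (toList v.left))).toList.length ∧ T₂ (keyD u v))
  have harcD : ∀ {f g h : Data → Data}, PolyTime f → PolyTime g → PolyTime h →
      PolyDec fun x => arcD (f x) (g x) (h x) := by
    intro f g h hf hg hh
    have hk : PolyTime fun x => keyD (g x) (h x) :=
      .pair (.pair hg.left.left hg.right) (.pair hh.left.left hh.right)
    exact .or (.and (PolyTime.polyDec_length_eq hg.left hh.left) (hT₀.comp hk))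
      (.or (.and (PolyTime.polyDec_length_eq hg.left (.pair .nil hh.left)) (hT₁.comp hk))
        (.and (PolyTime.polyDec_length_eq hg.left (.append hf hh.left)) (hT₂.comp hk)))
  let vertD : Data → Data := fun x =>
    encodeList ((encodeList (Data.suffixes (toList x.right))).toList.flatMap fun s =>
      (encodeList ((encodeList (Finset.univ.toList.map codeP)).toList.map fun π =>
        pair s π)).toList)
  have hvertD : PolyTime vertD :=
    .flatMap (F := fun _ s => encodeList ((encodeList (Finset.univ.toList.map codeP)).toList.map
      fun π => pair s π)) (.suffixes PolyTime.id.right)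
      (.map (F := fun z π => pair z.right π) (.const _)
        (.pair PolyTime.id.left.right PolyTime.id.right))
  refine ⟨fun x => encodeList ((vertD x).toList.map fun u => encodeList ((vertD x).toList.map
    fun v => encodeBool (decide (arcD x.left u v ∨ arcD x.left v u)))),
    .map (F := fun x u => encodeList ((vertD x).toList.map
      fun v => encodeBool (decide (arcD x.left u v ∨ arcD x.left v u)))) hvertD
      (.map (F := fun z v => encodeBool (decide (arcD z.left.left z.right v ∨
        arcD z.left.left v z.right))) (hvertD.comp PolyTime.id.left)
        ((PolyDec.or (harcD PolyTime.id.left.left.left PolyTime.id.left.right PolyTime.id.right)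
          (harcD PolyTime.id.left.left.left PolyTime.id.right PolyTime.id.left.right)).congr
          fun _ => congrArg encodeBool (by congr))),
    fun nb ty M => ?_⟩
  let vs : List (Fin M × (Γ ⊕ S × E)) := List.finRange M ×ˢ Finset.univ.toList
  have hvs : vs.Nodup := (List.nodup_finRange M).product (Finset.nodup_toList _)
  have hmem : ∀ u, u ∈ vs := fun u => List.mem_product.2 ⟨List.mem_finRange _, by simp⟩
  refine ⟨vs.length, (𝓢.graph nb ty M).comap vs.get, ?_,
    ⟨SimpleGraph.Iso.comap (hvs.getEquivOfForallMemList vs hmem) _⟩⟩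
  rw [encodeGraph_comap_get]
  set L := (List.range M).map fun t => code (ty t) with hL
  let enc : Fin M × (Γ ⊕ S × E) → Data := fun u => pair (encodeList (L.drop u.1)) (codeP u.2)
  have hverts : (vertD (pair (encodeNat nb) (encodeList L))).toList = vs.map enc := by
    simp only [vertD, BinaryTree.right, toList_encodeList, Data.suffixes]
    have h1 : L.length = M := by simp [hL]
    rw [h1, ← List.map_coe_finRange_eq_range]
    simp only [List.map_map, List.flatMap_map, vs, SProd.sprod, List.product, List.map_flatMap]
    rfl
  have harc : ∀ u v, arcD (encodeNat nb) (enc u) (enc v) ↔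
      𝓢.Arc nb ty (u.1, u.2) (v.1, v.2) := by
    rintro ⟨⟨t, ht⟩, x⟩ ⟨⟨t', ht'⟩, y⟩
    have hhead : ∀ t < M, (encodeList (L.drop t)).left = code (ty t) := by
      intro t ht
      rw [List.drop_eq_getElem_cons (by simpa [hL] using ht)]
      simp [encodeList, BinaryTree.left, hL]
    have hk : keyD (enc (⟨t, ht⟩, x)) (enc (⟨t', ht'⟩, y)) = key ((ty t, x), (ty t', y)) := by
      simp only [keyD, enc, key]
      change pair (pair (encodeList (L.drop t)).left _) (pair (encodeList (L.drop t')).left _) = _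
      rw [hhead t ht, hhead t' ht']
      rfl
    have h0 : M - t = M - t' ↔ t = t' := by omega
    have h1 : M - t = M - t' + 1 ↔ t' = t + 1 := by omega
    have h2 : M - t = nb + (M - t') ↔ t' = t + nb := by omega
    simp only [arcD, hk, hT₀', hT₁', hT₂']
    simp only [enc, BinaryTree.left, toList_encodeList, toList_pair, List.length_cons,
      List.length_append, toList_encodeNat, List.length_replicate, List.length_drop, hL,
      List.length_map, List.length_range, h0, h1, h2]
    rcases x with x | q <;> rcases y with y | q' <;> simp [Arc]
  beta_reduce
  simp only [hverts, List.map_map, Function.comp_def]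
  have hl : BinaryTree.left (pair (encodeNat nb) (encodeList L)) = encodeNat nb := rfl
  simp only [hl, harc]
  exact congrArg encodeList (List.map_congr_left fun u _ => congrArg encodeList
    (List.map_congr_left fun v _ => congrArg encodeBool (decide_eq_decide.2 Iff.rfl)))

end LayerScheme

/-! ### The reduction and the contradiction to SETH -/

open Data Polynomial

theorem exists_surjective_of_card_le {α β : Type*} [Finite α] [Finite β] [Nonempty α]
    (h : Nat.card α ≤ Nat.card β) : ∃ f : β → α, Function.Surjective f := by
  have := Fintype.ofFinite α
  have := Fintype.ofFinite β
  rw [Nat.card_eq_fintype_card, Nat.card_eq_fintype_card] at h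
  obtain ⟨g⟩ := Function.Embedding.nonempty_of_card_le h
  exact ⟨Function.invFun g, Function.invFun_surjective g.injective⟩

/-- Satisfiability reduces to the homomorphism problem for a product with a projective factor; the
clique-width of the constructed graph is bounded in terms of the number of blocks of `a` variables,
where the assignments of a block are represented by `b` signature sets. -/
theorem exists_polyTime_reduction {X : Type u} {Y : Type*} [Finite X] [Finite Y] [Nontrivial X]
    {A : LoopGraph X} {B : LoopGraph Y} (hcore : (A.prod B).IsCore) (hA : ∀ x, ¬ A.Adj x x)
    (hne : ∀ x, ∃ y, A.Adj x y) {y₀ y₁ : Y} (hy : B.Adj y₀ y₁) {a b : ℕ} (ha : 0 < a)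
    (hab : 2 ^ a ≤ A.signatureNumber ^ b)
    (hproj : ∀ (D : Type u) [Finite D], 2 ≤ Nat.card D → A.ProjectiveFactor B D) :
    ∃ (f : Data → Data) (C : ℕ), PolyTime f ∧ ∀ φ : CNFFormula,
      ∃ (N : ℕ) (G : SimpleGraph (Fin N)), f φ.encode = encodeGraph G ∧
        (Nonempty (G.Adj →r (A.prod B).Adj) ↔ φ.Satisfiable) ∧
        cliqueWidth G ≤ (φ.n / a + 1) * b + C := by
  classical
  have := Fintype.ofFinite X
  have hthin : (A.prod B).IsThin := hcore.isThin fun v h => hA _ h.1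
  have : Finite A.signatureSets := Set.toFinite _
  have hW : Nat.card (Fin b → A.signatureSets) = A.signatureNumber ^ b := by
    rw [Nat.card_fun, Nat.card_fin, Nat.card_coe_set_eq]
    rfl
  -- `v` decodes a tuple of signature sets into an assignment of a block. Surjectivity suffices;
  -- several tuples may stand for the same assignment.
  obtain ⟨v, hv⟩ := exists_surjective_of_card_le (α := Fin a → Bool)
    (β := Fin b → A.signatureSets) (by rw [hW]; simpa [Nat.card_fun] using hab)
  have : Nonempty (Fin b → A.signatureSets) := ⟨(hv fun _ => false).choose⟩
  obtain ⟨c₀, c₁, hc⟩ := exists_pair_ne X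
  let color : Bool → X := fun i => if i then c₁ else c₀
  have hcolor : Function.Injective color := by
    intro i j h
    cases i <;> cases j <;> simp_all [color, eq_comm]
  let D := (Fin b → A.signatureSets) × Bool
  have hD : A.ProjectiveFactor B D := hproj D Finite.one_lt_card
  let val : D → Fin b → A.signatureSets := fun d => d.1
  let 𝓢 := LoopGraph.homScheme A hA B val (fun (l : LayerType a) d => color (l.inBit d))
    (fun l d => color (LayerType.outBit v l d)) y₀ y₁
  have := Fintype.ofFinite ((D → X) × Y)
  obtain ⟨code, hcode⟩ := exists_code (LayerType a)
  obtain ⟨f, hf, hf'⟩ := CNFFormula.exists_polyTime_layerTypes ha code (b * Fintype.card X)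
  obtain ⟨g, hg, hg'⟩ := 𝓢.exists_polyTime_graph hcode
  refine ⟨fun x => g (pair (pair .nil (encodeNat ((toList x.left).length / a))) (f x)),
    2 * Fintype.card ((D → X) × Y) + 2,
    hg.comp (.pair (.pair .nil (PolyTime.divMod ha PolyTime.id.left).left) hf), fun φ => ?_⟩
  set nb := φ.n / a + 1 with hnb
  -- The number of passes exceeds by one the number of times that the sets of all blocks can shrink.
  set R := nb * (b * Fintype.card X) + 1 with hR
  set M := R * (φ.passOps ha).length * nb with hM
  obtain ⟨N, G, h1, ⟨e⟩⟩ := hg' nb (φ.layerTypes ha) M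
  refine ⟨N, G, ?_, ?_, (cliqueWidth_congr e).trans_le ((𝓢.cliqueWidth_graph_le
    (Nat.succ_pos _)).trans_eq ?_)⟩
  · beta_reduce
    rw [← h1, hf']
    have : BinaryTree.left φ.encode = encodeNat φ.n := rfl
    simp only [this, toList_encodeNat, List.length_replicate, hnb, encodeNat_succ]
    rfl
  · have hiff : Nonempty (G.Adj →r (A.prod B).Adj) ↔
        Nonempty ((𝓢.graph nb (φ.layerTypes ha) M).Adj →r (A.prod B).Adj) :=
      ⟨fun ⟨h⟩ => ⟨h.comp (e.symm : _ →r G.Adj)⟩, fun ⟨h⟩ => ⟨h.comp (e : G.Adj →r _)⟩⟩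
    rw [hiff]
    constructor
    · rintro ⟨h⟩
      obtain ⟨d, h2, h3⟩ := LoopGraph.exists_choice_of_hom hcore hthin hne hD hy h
      refine φ.satisfiable_of_choice ha (S := Fin b) (X := X) (v := v)
        (val := fun w p => (w p : Set X)) (fun w w' hww => funext fun p => Subtype.ext (hww p))
        (R := R) (by simp [hR, hnb]) d (fun t ht => hcolor (h2 t ht)) (fun t p ht => h3 t p ht)
    · intro hφ
      -- Without clauses a pass is empty, and the graph has no vertices.
      by_cases hcl : φ.clauses = []
      · have hM0 : M = 0 := by simp [hM, CNFFormula.passOps, hcl]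
        rw [hM0]
        exact LoopGraph.hom_of_choice hne hy (fun _ => Classical.arbitrary D)
          (fun t ht => absurd ht (Nat.not_lt_zero _)) (fun t p ht => absurd ht (Nat.not_lt_zero _))
      · obtain ⟨d, h2, h3⟩ := φ.exists_choice_of_satisfiable ha hv hφ hcl
        exact LoopGraph.hom_of_choice hne hy d (fun t _ => congrArg color (h2 t))
          (fun t p _ => by simp only [val, hnb, h3]; exact subset_rfl)
  · rw [Fintype.card_fin]

theorem Polynomial.eval_le_mul_pow (P : ℕ[X]) {s : ℕ} (hs : 1 ≤ s) :
    P.eval s ≤ P.eval 1 * s ^ P.natDegree := by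
  rw [eval_eq_sum_range, eval_eq_sum_range, Finset.sum_mul]
  refine Finset.sum_le_sum fun i hi => ?_
  rw [one_pow, mul_one]
  exact Nat.mul_le_mul_left _ (Nat.pow_le_pow_right hs (by simpa [Nat.lt_succ_iff] using hi))

theorem Runs.pos {p : Prog} {x y : Data} {t : ℕ} (h : Runs p x y t) : 0 < t := by
  cases h <;> omega

theorem cliqueWidth_singleton (G : SimpleGraph (Fin 1)) : cliqueWidth G = 1 := by
  have h1 : cliqueWidth G ≤ 1 := by
    have := (CWBuilt.singleton G (fun _ => Unit.unit) 0)
    have h : ({0} : Set (Fin 1)) = Set.univ := by ext x; simp [Subsingleton.elim x 0]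
    rw [h] at this
    simpa using this.cliqueWidth_le
  refine le_antisymm h1 (Nat.one_le_iff_ne_zero.2 fun h0 => ?_)
  have hmem : cliqueWidth G ∈ {k : ℕ | ∃ a : CWExpr k, Nonempty (a.graph ≃g G)} := by
    refine Nat.sInf_mem ⟨1, .vertex 0, ⟨⟨⟨fun _ => 0, fun _ => Unit.unit, ?_, ?_⟩, ?_⟩⟩⟩
    · intro x; cases x; rfl
    · intro x; exact Subsingleton.elim _ _
    · intro x y
      have h2 : ¬ G.Adj 0 0 := G.irrefl
      exact ⟨fun h => (h2 h).elim, fun h => h.elim⟩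
  rw [h0] at hmem
  obtain ⟨a, -⟩ := hmem
  have : ∀ a : CWExpr 0, False := by
    intro a
    induction a with
    | vertex i => exact i.elim0
    | union a b ih _ => exact ih
    | relabel i => exact i.elim0
    | join i => exact i.elim0
  exact this a

/-- On the graph with one vertex, which has clique-width 1, a program takes at least one step, so
the time bound must be positive. This excludes a negative base, whose powers would not be monotone.
-/
theorem HColoringSolvable.base_pos {V : Type*} {H : LoopGraph V} {β : ℝ}
    (h : HColoringSolvable H β) : 0 < β := by
  obtain ⟨p, c, d, h⟩ := h
  obtain ⟨y, t, h1, -, h2⟩ := h ⟨1, ⊥⟩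
  by_contra! hβ
  simp only [cliqueWidth_singleton, pow_one] at h2
  have h3 : (0 : ℝ) < t := by exact_mod_cast h1.pos
  have h4 : (c : ℝ) * ((encodeGraph (⊥ : SimpleGraph (Fin 1))).size : ℝ) ^ d * β ≤ 0 :=
    mul_nonpos_of_nonneg_of_nonpos (by positivity) hβ
  linarith

/-- Numbers `a` and `b` for which `s ^ b` exceeds `2 ^ a`, but `β ^ b` is smaller. -/
theorem exists_block_sizes {s : ℕ} {β : ℝ} (hβ : 1 ≤ β) (hs : β < s) :
    ∃ a b : ℕ, 0 < a ∧ 2 ^ a ≤ s ^ b ∧ β ^ b < 2 ^ a := by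
  have hβ0 : 0 < β := by linarith
  -- The factor 2 between `β ^ b` and `s ^ b` makes room for rounding `s ^ b` down to a power of 2.
  obtain ⟨b, hb⟩ := pow_unbounded_of_one_lt 2 ((one_lt_div hβ0).2 hs)
  have h1 : 2 * β ^ b < (s : ℝ) ^ b := by
    rwa [div_pow, lt_div_iff₀ (by positivity)] at hb
  have h2 : 2 ≤ s ^ b := by
    have : (2 : ℝ) ≤ (s : ℝ) ^ b := by
      have := one_le_pow₀ hβ (n := b)
      linarith
    exact_mod_cast this
  refine ⟨Nat.log 2 (s ^ b), b, Nat.log_pos (by norm_num) h2,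
    Nat.pow_log_le_self 2 (by omega), ?_⟩
  have h3 : s ^ b < 2 ^ (Nat.log 2 (s ^ b) + 1) := Nat.lt_pow_succ_log_self (by norm_num) _
  have h4 : (s : ℝ) ^ b < 2 ^ (Nat.log 2 (s ^ b) + 1) := by exact_mod_cast h3
  rw [pow_succ] at h4
  linarith

/-- An algorithm for `H`-colouring and a reduction from satisfiability together give an algorithm
for satisfiability. -/
theorem solvable_of_reduction {V : Type*} {H : LoopGraph V} {β β' q : ℝ} (hβ0 : 0 ≤ β)
    (hβ : β ≤ β') (hβ' : 1 ≤ β') (h : HColoringSolvable H β) {a b C : ℕ} (hq : 1 ≤ q)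
    (hqa : q ^ a = β' ^ b) {f : Data → Data} (hf : PolyTime f)
    (hred : ∀ φ : CNFFormula, ∃ (N : ℕ) (G : SimpleGraph (Fin N)), f φ.encode = encodeGraph G ∧
        (Nonempty (G.Adj →r H.Adj) ↔ φ.Satisfiable) ∧ cliqueWidth G ≤ (φ.n / a + 1) * b + C)
    (k : ℕ) : SolvableInOStar (I := {φ : CNFFormula // φ.HasWidth k}) (fun φ => φ.1.encode)
      (fun φ => φ.1.Satisfiable) (fun φ => q ^ φ.1.n) := by
  obtain ⟨p, c, d, hp⟩ := h
  obtain ⟨r, P, hr⟩ := hf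
  -- `K` absorbs the cost of the extra block and of the additive constant `C` in the clique-width.
  obtain ⟨K, hK⟩ := exists_nat_ge (β' ^ (b + C))
  let Q : ℕ[X] := P + 1 + (Polynomial.C c * P ^ d) * Polynomial.C K
  refine ⟨.seq r p, Q.eval 1, Q.natDegree, ?_⟩
  rintro ⟨φ, -⟩
  obtain ⟨N, G, hG, hsat, hcw⟩ := hred φ
  obtain ⟨hsz, t₁, ht₁, hrun₁⟩ := hr φ.encode
  obtain ⟨y, t₂, hrun₂, hy, ht₂⟩ := hp ⟨N, G⟩
  rw [hG] at hrun₁ hsz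
  refine ⟨y, t₁ + t₂ + 1, .seq hrun₁ hrun₂, hy.trans hsat, ?_⟩
  dsimp only at ht₂ ⊢
  set sz := φ.encode.size with hszdef
  have hqn : (1 : ℝ) ≤ q ^ φ.n := one_le_pow₀ hq
  have hpow : β ^ cliqueWidth G ≤ K * q ^ φ.n := by
    calc β ^ cliqueWidth G ≤ β' ^ cliqueWidth G := pow_le_pow_left₀ hβ0 hβ _
      _ ≤ β' ^ ((φ.n / a + 1) * b + C) := pow_le_pow_right₀ hβ' hcw
      _ = β' ^ (b + C) * (q ^ a) ^ (φ.n / a) := by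
        rw [hqa, ← pow_mul, ← pow_add]; congr 1; ring
      _ = β' ^ (b + C) * q ^ (a * (φ.n / a)) := by rw [pow_mul]
      _ ≤ K * q ^ φ.n := mul_le_mul hK (pow_le_pow_right₀ hq (Nat.mul_div_le _ _))
          (by positivity) (by positivity)
  have h2 : (t₂ : ℝ) ≤ c * ((P.eval sz : ℕ) : ℝ) ^ d * (K * q ^ φ.n) := by
    refine ht₂.trans (mul_le_mul ?_ hpow (by positivity) (by positivity))
    have : ((encodeGraph G).size : ℝ) ≤ ((P.eval sz : ℕ) : ℝ) := by exact_mod_cast hsz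
    gcongr
  have h3 : ((t₁ + t₂ + 1 : ℕ) : ℝ) ≤ ((Q.eval sz : ℕ) : ℝ) * q ^ φ.n := by
    have h4 : (t₁ : ℝ) ≤ ((P.eval sz : ℕ) : ℝ) := by exact_mod_cast ht₁
    have h5 : ((P.eval sz : ℕ) : ℝ) + 1 ≤ (((P.eval sz : ℕ) : ℝ) + 1) * q ^ φ.n :=
      le_mul_of_one_le_right (by positivity) hqn
    simp only [Q, eval_add, eval_mul, eval_pow, eval_C, eval_one]
    push_cast
    nlinarith
  refine h3.trans (mul_le_mul_of_nonneg_right ?_ (by positivity))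
  exact_mod_cast Q.eval_le_mul_pow (one_le_size _)

theorem theorem2 {V : Type u} [Finite V] (H : LoopGraph V) (hcore : H.IsCore)
    (hnontrivial : ¬ H.IsTrivial) {m : ℕ} {W : Fin m → Type u} (F : ∀ i, LoopGraph (W i))
    (hF : H.IsPrimeFactorization F) (i : Fin m) (hproj : LoopGraph.IsProjectiveAt F i)
    (hSETH : SETH) (ε : ℝ) (hε : 0 < ε) :
    ¬ HColoringSolvable H (((F i).signatureNumber : ℝ) - ε) := by
  intro hsolv
  obtain ⟨hprime, ⟨e₀⟩⟩ := hF
  let e := e₀.trans (LoopGraph.piSplitIso F i)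
  have hcore' := hcore.congr e
  have hA := LoopGraph.not_adj_self_of_not_isTrivial hproj.1
  obtain ⟨y₀, y₁, hy⟩ : ∃ y₀ y₁, (LoopGraph.pi fun j : {j : Fin m // j ≠ i} => F j).Adj y₀ y₁ := by
    obtain ⟨v, w, h⟩ := LoopGraph.exists_adj_of_not_isTrivial hnontrivial
    exact ⟨_, _, (e.map_rel_iff.2 h).2⟩
  have hne := ((hcore'.isThin fun v h => hA _ h.1).of_prod y₀).exists_adj
    (LoopGraph.exists_adj_of_not_isTrivial hproj.1)
  have : Nontrivial (W i) := (hprime i).1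
  -- Finiteness is assumed for `V` only; each of the two factors embeds in the product, the other
  -- coordinate being fixed.
  have : Finite (W i) := Finite.of_injective (fun x => e.symm (x, y₀)) fun x x' h =>
    congrArg Prod.fst (e.symm.injective h)
  have : Finite (∀ j : {j : Fin m // j ≠ i}, W j) :=
    Finite.of_injective (fun y => e.symm (Classical.arbitrary (W i), y)) fun y y' h =>
      congrArg Prod.snd (e.symm.injective h)
  have hs : 2 ≤ (F i).signatureNumber :=
    (Finite.one_lt_card (α := W i)).trans_le (LoopGraph.IsThin.card_le_signatureNumber
      ((hcore'.isThin fun v h => hA _ h.1).of_prod y₀) hne)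
  have hpos := hsolv.base_pos
  set s := (F i).signatureNumber with hsdef
  have hs' : (2 : ℝ) ≤ s := by exact_mod_cast hs
  -- For large `ε` the base may be below 1; it is raised to 1 so that the bound is monotone in the
  -- clique-width.
  have hβ : max ((s : ℝ) - ε) 1 < s := max_lt (by linarith) (by linarith)
  obtain ⟨a, b, ha, hab, hb⟩ := exists_block_sizes (le_max_right ((s : ℝ) - ε) 1) hβ
  set β' := max ((s : ℝ) - ε) 1 with hβ'
  have h1 : 1 ≤ β' := le_max_right _ _
  have hβb : 1 ≤ β' ^ b := one_le_pow₀ h1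
  -- This base satisfies `q ^ a = β' ^ b`: a block of `a` variables costs `b` labels. It is below 2
  -- because `β' ^ b < 2 ^ a`.
  let q : ℝ := (β' ^ b) ^ ((a : ℝ)⁻¹)
  have hq1 : 1 ≤ q := Real.one_le_rpow hβb (by positivity)
  have hqa : q ^ a = β' ^ b := Real.rpow_inv_natCast_pow (by linarith) ha.ne'
  have hq2 : q < 2 := by
    refine lt_of_pow_lt_pow_left₀ a (by norm_num) ?_
    rwa [hqa]
  obtain ⟨f, C, hf, hred⟩ := exists_polyTime_reduction hcore' hA hne hy ha hab
    fun D _ hD => hproj.projectiveFactor D hD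
  obtain ⟨k, hk⟩ := hSETH (2 - q) (by linarith)
  rw [sub_sub_cancel] at hk
  refine hk (solvable_of_reduction hpos.le (le_max_left _ _) h1 hsolv (C := C) hq1 hqa hf (fun φ => ?_) k)
  obtain ⟨N, G, h2, h3, h4⟩ := hred φ
  refine ⟨N, G, h2, Iff.trans ?_ h3, h4⟩
  exact ⟨fun ⟨h⟩ => ⟨(e : H.Adj →r _).comp h⟩, fun ⟨h⟩ => ⟨(e.symm : _ →r H.Adj).comp h⟩⟩
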